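/- Let $N\ge 1$. \textbf{Chains.} An $N$-chain is $c=(c_0,\dots,c_{N+1})\in(\mathbb R^2)^{N+2}$. Its rays are $R_0$, the half-line with closed end point $c_1$ passing through $c_0$ (empty if $c_0=c_1$), and $R_j=[c_j,c_{j+1}]$ for $1\le j\le N$. Let $\mathrm{LO}^N(\mathbb R^2)$ be the space of $N$-chains such that $R_0\ne\varnothing$, $c_k\notin R_j$ whenever $0\le j\le N$, $1\le k\le N+1$, $k\ne j,j+1$, and $c_i$ is not in the open segment $(c_{i-1},c_{i+1})$ for $1\le i\le N$. \textbf{Beams.} A primary $N$-beam is a pair $F=((a_i),(b_i))$ of $N$-chains with $a_0=b_0=(-1,0)$, $a_{N+1}=b_{N+1}$, $\frac{a_1+b_1}2=0$ and $a_k\neq b_k$ for $1\le k\le N$. Put $S_i=[a_i,b_i]$. For $t\in[0,1]$ its $t$-chain $P^t$ is defined by $P^t_1=(1-t)a_1+tb_1$, $P_0^t=P_1^t+a_0$, and for $2\le i\le N+1$: if the lines $(a_{i-1}a_i)$ and $(b_{i-1}b_i)$ meet, at $I$, then $P_i^t$ is the point of $[a_i,b_i]$ on the line $(P^t_{i-1}I)$;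 otherwise $P_i^t=(1-\lambda)a_i+\lambda b_i$, where $P_{i-1}^t=(1-\lambda)a_{i-1}+\lambda b_{i-1}$. An $N$-beam is a primary $N$-beam such that (non-obscuration) for all $0\le j\le N$, $t\in[0,1]$ and $1\le k\le N+1$ with $k\neq j,j+1$, the $j$-th ray of $P^t$ does not meet $S_k$; (reflexion) for $1\le i\le N$, with $n_i$ a unit normal of $S_i$, the four numbers $(a_{i-1}-a_i)\cdot n_i$, $(b_{i-1}-b_i)\cdot n_i$, $(a_{i+1}-a_i)\cdot n_i$, $(b_{i+1}-b_i)\cdot n_i$ are nonzero and have the same sign. (The reflexion condition makes all $t$-chains well defined.) Let $\mathrm{Faisc}^N(\mathbb R^2)$ be the space of $N$-beams, with the topology induced by $(\mathbb R^2)^{2(N+2)}$, and let $\mathrm{Faisc}_{\mathrm{Sym}}^N(\mathbb R^2)$ be its quotient, with the quotient topology, by the action of $\mathbb Z/2\mathbb Z$ that exchanges $(a_i)$ and $(b_i)$. \textbf{Invariants.} Let $F=((a_i),(b_i))$ be a beam, and let $c=P^{1/2}$ be its centered chain, which belongs to $\mathrm{LO}^N(\mathbb R^2)$. The nomenclature of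 $F$ is the connected component of $c$ in $\mathrm{LO}^N(\mathbb R^2)$. For $x\ne0$ let $A(x)\in\mathbb R/2\pi\mathbb Z$ be the angle of $x$. For $1\le j\le N$ the angle $\theta_j=A(a_j-b_j)$ lies in exactly one of the two sets $$\mathcal A_j^{\pm}=\bigl(A(c_j-c_{j-1})\pm(-1)^j\,]0,\pi[\bigr)\cap\bigl(A(c_j-c_{j+1})\pm(-1)^j\,]0,\pi[\bigr);$$ the characteristic of $F$ is $\mathrm{Car}(F)\in\{-1,1\}^N$, where $\mathrm{Car}(F)_j=1$ if $\theta_j\in\mathcal A_j^+$ and $\mathrm{Car}(F)_j=-1$ if $\theta_j\in\mathcal A_j^-$. The signature of $F$ is the element of $\{-1,1\}^{N-1}$ whose $k$-th entry is $1$ if $\mathrm{Car}(F)_k=\mathrm{Car}(F)_{k+1}$ and $-1$ otherwise. The nomenclature and the signature are unchanged when $(a_i)$ and $(b_i)$ are exchanged; let $\mathrm I^{\mathrm S}=(\mathrm N^{\mathrm S},\mathrm{sign}^{\mathrm S})$ be the induced map from $\mathrm{Faisc}_{\mathrm{Sym}}^N(\mathbb R^2)$ to $\pi_0(\mathrm{LO}^N(\mathbb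 R^2))\times\{-1,1\}^{N-1}$, where $\pi_0$ is the set of connected components. \textbf{Theorem.} The map $\mathrm I^{\mathrm S}$ is an exact topological invariant of $\mathrm{Faisc}_{\mathrm{Sym}}^N(\mathbb R^2)$: for all $\mathcal F,\mathcal F'\in\mathrm{Faisc}_{\mathrm{Sym}}^N(\mathbb R^2)$, one has $\mathrm I^{\mathrm S}(\mathcal F)=\mathrm I^{\mathrm S}(\mathcal F')$ if and only if $\mathcal F$ and $\mathcal F'$ are joined by a continuous path in $\mathrm{Faisc}_{\mathrm{Sym}}^N(\mathbb R^2)$, and also if and only if they lie in the same connected component of $\mathrm{Faisc}_{\mathrm{Sym}}^N(\mathbb R^2)$. -/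

import Mathlib

noncomputable section

namespace OpticalBeam

/-- The Euclidean plane. -/
abbrev Plane : Type := EuclideanSpace ℝ (Fin 2)

/-- The cross product of two plane vectors. -/
def cross (u v : Plane) : ℝ := u 0 * v 1 - u 1 * v 0

/-- `N`-polygonal chains `(c₀, …, c_{N+1})`, with the product topology. -/
abbrev Chain (N : ℕ) : Type := Fin (N + 2) → Plane

/-! The mirrors `1, …, N` are indexed by `i : Fin N`, the mirror number being `i + 1`. -/

/-- The index of the point that precedes the mirror `i + 1`. -/
def prevIdx {N : ℕ} (i : Fin N) : Fin (N + 2) := i.castSucc.castSucc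

/-- The index of the mirror `i + 1`. -/
def midIdx {N : ℕ} (i : Fin N) : Fin (N + 2) := i.castSucc.succ

/-- The index of the point that follows the mirror `i + 1`. -/
def nextIdx {N : ℕ} (i : Fin N) : Fin (N + 2) := i.succ.succ

/-! ### Polygonal chains -/

/-- The half-line with (closed) end point `q` passing through `p`; empty if `p = q`. -/
def halfLine (p q : Plane) : Set Plane :=
  {x | p ≠ q ∧ ∃ s : ℝ, 0 ≤ s ∧ x = q + s • (p - q)}

/-- The `j`-th ray, `0 ≤ j ≤ N`: the source half-line for `j = 0`, else `[c_j, c_{j+1}]`. -/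
def ray {N : ℕ} (c : Chain N) (j : Fin (N + 1)) : Set Plane :=
  if j = 0 then halfLine (c 0) (c 1) else segment ℝ (c j.castSucc) (c j.succ)

/-- The obscuration clause. -/
def Obsc {N : ℕ} (c : Chain N) : Prop :=
  ∃ j : Fin (N + 1),
    (∃ k : Fin (N + 2), k ≠ 0 ∧ k ≠ j.castSucc ∧ k ≠ j.succ ∧ c k ∈ ray c j) ∨ ray c j = ∅

/-- The grazing clause. -/
def Graz {N : ℕ} (c : Chain N) : Prop :=
  ∃ i : Fin N, c (midIdx i) ∈ openSegment ℝ (c (prevIdx i)) (c (nextIdx i))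

/-- The space of polygonal chains without obscuration and grazing. -/
def LO (N : ℕ) : Set (Chain N) := {c | ¬ (Obsc c ∨ Graz c)}

/-- The nomenclature of a polygonal chain: its connected component in `LO N`. -/
def nomenclature {N : ℕ} (L : LO N) : ConnectedComponents (LO N) := L

/-! ### Reflexive polygonal chains -/

/-- The angle of a nonzero vector, in `ℝ / 2πℤ`. -/
def angle (x : Plane) : Real.Angle := ((Complex.mk (x 0) (x 1)).arg : Real.Angle)

/-- The unit normal of the lines of angle `θ`. -/
def normalOfAngle (θ : Real.Angle) : Plane := !₂[-θ.sin, θ.cos]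

/-- The space of reflexive polygonal chains `((cᵢ), (θⱼ))`. -/
def LR (N : ℕ) : Set (Chain N × (Fin N → Real.Angle)) :=
  {L | L.1 ∈ LO N ∧ ∀ j : Fin N,
    SignType.sign (inner ℝ (L.1 (nextIdx j) - L.1 (midIdx j)) (normalOfAngle (L.2 j))) =
      SignType.sign (inner ℝ (L.1 (prevIdx j) - L.1 (midIdx j)) (normalOfAngle (L.2 j))) ∧
    SignType.sign (inner ℝ (L.1 (prevIdx j) - L.1 (midIdx j)) (normalOfAngle (L.2 j))) ≠ 0}

/-- The set `α + ε ]0, π[` of angles. -/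
def halfCircle (α : Real.Angle) (ε : ℝ) : Set Real.Angle :=
  {φ | ∃ s ∈ Set.Ioo (0 : ℝ) Real.pi, φ = α + ((ε * s : ℝ) : Real.Angle)}

/-- The positive orientations of the mirror `j + 1`. -/
def posOrientation {N : ℕ} (c : Chain N) (j : Fin N) : Set Real.Angle :=
  halfCircle (angle (c (midIdx j) - c (prevIdx j))) ((-1) ^ ((j : ℕ) + 1)) ∩
    halfCircle (angle (c (midIdx j) - c (nextIdx j))) ((-1) ^ ((j : ℕ) + 1))

/-- The negative orientations of the mirror `j + 1`. -/
def negOrientation {N : ℕ} (c : Chain N) (j : Fin N) : Set Real.Angle :=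
  halfCircle (angle (c (midIdx j) - c (prevIdx j))) ((-1) ^ ((j : ℕ) + 2)) ∩
    halfCircle (angle (c (midIdx j) - c (nextIdx j))) ((-1) ^ ((j : ℕ) + 2))

open Classical in
/-- The characteristic, with values in `{-1, 1}^N`. On `LR N` every angle that is not a positive
orientation is a negative one: see `LR_pos_or_neg` and
`LR_not_pos_and_neg`. -/
def car {N : ℕ} (L : LR N) : Fin N → ℤˣ :=
  fun j => if L.1.2 j ∈ posOrientation L.1.1 j then 1 else -1

/-! ### Primary beams and their `t`-polygonal chains -/

/-- The space of primary beams `((aᵢ), (bᵢ))`. -/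
def FaiscP (N : ℕ) : Set (Chain N × Chain N) :=
  {F | (∀ k : Fin N, F.1 (midIdx k) ≠ F.2 (midIdx k)) ∧
    F.1 0 = !₂[-1, 0] ∧ F.2 0 = !₂[-1, 0] ∧
    F.1 (Fin.last (N + 1)) = F.2 (Fin.last (N + 1)) ∧
    midpoint ℝ (F.1 1) (F.2 1) = 0}

/-- The point of a one-point set. -/
def thePoint (s : Set Plane) : Plane := Classical.epsilon (fun x => x ∈ s)

/-- The `lam ∈ [0, 1]` with `p = (1 - lam) a + lam b`. -/
def param (a b p : Plane) : ℝ :=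
  Classical.epsilon (fun lam : ℝ => lam ∈ Set.Icc (0 : ℝ) 1 ∧ p = AffineMap.lineMap a b lam)

/-- The intersection of the lines `(a a')` and `(b b')`. -/
def focus (a b a' b' : Plane) : Set Plane :=
  {x | x ∈ line[ℝ, a, a'] ∧ x ∈ line[ℝ, b, b']}

open Classical in
/-- The impact point on `[a', b']` of the ray issued from the point `p` of `[a, b]`: the ray passes
through the common point of the lines `(a a')` and `(b b')`, and if these lines do not meet then
it divides `[a', b']` in the same ratio as `[a, b]`. -/
def nextImpact (a b a' b' p : Plane) : Plane :=
  if (focus a b a' b').Nonempty then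
    thePoint {x | x ∈ line[ℝ, p, thePoint (focus a b a' b')] ∧ x ∈ segment ℝ a' b'}
  else AffineMap.lineMap a' b' (param a b p)

/-- The impact points `1, …, N + 1` (shifted by one) of the `t`-polygonal chain. -/
def impacts {N : ℕ} (F : Chain N × Chain N) (t : ℝ) (i : Fin (N + 1)) : Plane :=
  Fin.induction (motive := fun _ => Plane)
    (AffineMap.lineMap (F.1 1) (F.2 1) t)
    (fun i p => nextImpact (F.1 (midIdx i)) (F.2 (midIdx i)) (F.1 (nextIdx i)) (F.2 (nextIdx i)) p)
    i

/-- The `t`-polygonal chain of a primary beam. -/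
def tChain {N : ℕ} (F : Chain N × Chain N) (t : ℝ) : Chain N :=
  Fin.cons (AffineMap.lineMap (F.1 1) (F.2 1) t + F.1 0) (impacts F t)

/-! ### Beams -/

/-- A unit normal of the segment `[a, b]`. -/
def unitNormal (a b : Plane) : Plane := ‖b - a‖⁻¹ • !₂[-(b - a) 1, (b - a) 0]

/-- The non-obscuration condition. -/
def NonObscuration {N : ℕ} (F : Chain N × Chain N) : Prop :=
  ∀ j : Fin (N + 1), ∀ t ∈ Set.Icc (0 : ℝ) 1, ∀ k : Fin (N + 2),
    k ≠ 0 → k ≠ j.castSucc → k ≠ j.succ →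
      ray (tChain F t) j ∩ segment ℝ (F.1 k) (F.2 k) = ∅

/-- The reflexion condition. -/
def Reflexion {N : ℕ} (F : Chain N × Chain N) : Prop :=
  ∀ i : Fin N,
    let a := F.1
    let b := F.2
    let n := unitNormal (a (midIdx i)) (b (midIdx i))
    SignType.sign (inner ℝ (a (prevIdx i) - a (midIdx i)) n) =
        SignType.sign (inner ℝ (b (prevIdx i) - b (midIdx i)) n) ∧
      SignType.sign (inner ℝ (b (prevIdx i) - b (midIdx i)) n) =
        SignType.sign (inner ℝ (a (nextIdx i) - a (midIdx i)) n) ∧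
      SignType.sign (inner ℝ (a (nextIdx i) - a (midIdx i)) n) =
        SignType.sign (inner ℝ (b (nextIdx i) - b (midIdx i)) n) ∧
      SignType.sign (inner ℝ (b (nextIdx i) - b (midIdx i)) n) ≠ 0

/-- The space of beams, with the topology induced by `(ℝ²)^{2(N+2)}`. -/
def Faisc (N : ℕ) : Set (Chain N × Chain N) :=
  {F | F ∈ FaiscP N ∧ NonObscuration F ∧ Reflexion F}

/-! ### Facts that make the applications below well defined -/

lemma inner_plane (x y : Plane) : inner ℝ x y = x 0 * y 0 + x 1 * y 1 := by
  simp [PiLp.inner_apply, Fin.sum_univ_two, mul_comm]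

lemma inner_unitNormal (a b x : Plane) :
    inner ℝ x (unitNormal a b) = ‖b - a‖⁻¹ * cross (b - a) x := by
  simp only [inner_plane, unitNormal, cross, PiLp.smul_apply, PiLp.sub_apply, smul_eq_mul,
    Matrix.cons_val_zero, Matrix.cons_val_one]
  ring

lemma sign_inner_unitNormal {a b : Plane} (h : a ≠ b) (x : Plane) :
    SignType.sign (inner ℝ x (unitNormal a b)) = SignType.sign (cross (b - a) x) := by
  have : 0 < ‖b - a‖⁻¹ := inv_pos.2 (norm_pos_iff.2 (sub_ne_zero.2 h.symm))
  rw [inner_unitNormal, sign_mul, sign_pos this, one_mul]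

lemma mul_pos_of_sign_eq {x y : ℝ} (h : SignType.sign x = SignType.sign y)
    (h0 : SignType.sign y ≠ 0) : 0 < y * x := by
  rcases lt_trichotomy y 0 with hy | hy | hy
  · rw [sign_neg hy, sign_eq_neg_one_iff] at h
    exact mul_pos_of_neg_of_neg hy h
  · simp [hy] at h0
  · rw [sign_pos hy, sign_eq_one_iff] at h
    exact mul_pos hy h

/-- The reflexion condition in terms of cross products. -/
lemma reflexion_cross {N : ℕ} {F : Chain N × Chain N} (hP : F ∈ FaiscP N) (hR : Reflexion F)
    (i : Fin N) : ∃ σ : ℝ,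
      0 < σ * cross (F.2 (midIdx i) - F.1 (midIdx i)) (F.1 (prevIdx i) - F.1 (midIdx i)) ∧
      0 < σ * cross (F.2 (midIdx i) - F.1 (midIdx i)) (F.2 (prevIdx i) - F.2 (midIdx i)) ∧
      0 < σ * cross (F.2 (midIdx i) - F.1 (midIdx i)) (F.1 (nextIdx i) - F.1 (midIdx i)) ∧
      0 < σ * cross (F.2 (midIdx i) - F.1 (midIdx i)) (F.2 (nextIdx i) - F.2 (midIdx i)) := by
  have hne := hP.1 i
  have h := hR i
  simp only [sign_inner_unitNormal hne] at h
  obtain ⟨h1, h2, h3, h4⟩ := h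
  exact ⟨_, mul_pos_of_sign_eq (h1.trans (h2.trans h3)) h4, mul_pos_of_sign_eq (h2.trans h3) h4,
    mul_pos_of_sign_eq h3 h4, mul_pos_of_sign_eq rfl h4⟩

lemma side {a b p x u v : Plane} {σ : ℝ} (hp : p ∈ segment ℝ a b) (hx : x ∈ segment ℝ u v)
    (hu : 0 < σ * cross (b - a) (u - a)) (hv : 0 < σ * cross (b - a) (v - b)) :
    0 < σ * cross (b - a) (x - p) := by
  obtain ⟨r, q, hr, hq, hrq, rfl⟩ := hp
  obtain ⟨s, t, hs, ht, hst, rfl⟩ := hx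
  have e : σ * cross (b - a) (s • u + t • v - (r • a + q • b)) =
      s * (σ * cross (b - a) (u - a)) + t * (σ * cross (b - a) (v - b)) := by
    obtain rfl : r = 1 - q := by linarith
    obtain rfl : s = 1 - t := by linarith
    simp only [cross, PiLp.sub_apply, PiLp.add_apply, PiLp.smul_apply, smul_eq_mul]
    ring
  rw [e]
  rcases hs.eq_or_lt with rfl | hs
  · have : t = 1 := by linarith
    subst this; simpa using hv
  · have := mul_pos hs hu
    have := mul_nonneg ht hv.le
    linarith

lemma thePoint_mem {s : Set Plane} (h : s.Nonempty) : thePoint s ∈ s :=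
  Classical.epsilon_spec (p := fun x => x ∈ s) h

lemma param_spec {a b p : Plane} (h : p ∈ segment ℝ a b) :
    param a b p ∈ Set.Icc (0 : ℝ) 1 ∧ p = AffineMap.lineMap a b (param a b p) := by
  have : ∃ lam : ℝ, lam ∈ Set.Icc (0 : ℝ) 1 ∧ p = AffineMap.lineMap a b lam := by
    rw [segment_eq_image_lineMap] at h
    obtain ⟨l, hl, rfl⟩ := h
    exact ⟨l, hl, rfl⟩
  exact Classical.epsilon_spec this

lemma lineMap_mem_segment {a b : Plane} {t : ℝ} (ht : t ∈ Set.Icc (0 : ℝ) 1) :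
    AffineMap.lineMap a b t ∈ segment ℝ a b := by
  rw [segment_eq_image_lineMap]; exact ⟨t, ht, rfl⟩

/-- The impact point is on the mirror that the ray reaches. -/
lemma nextImpact_mem {a b a' b' p : Plane} {σ : ℝ} (hp : p ∈ segment ℝ a b)
    (h1 : 0 < σ * cross (b - a) (a' - a)) (h2 : 0 < σ * cross (b - a) (b' - b))
    (h3 : a' = b' ∨ ∃ τ : ℝ, 0 < τ * cross (b' - a') (a - a') ∧
      0 < τ * cross (b' - a') (b - b')) :
    nextImpact a b a' b' p ∈ segment ℝ a' b' := by
  unfold nextImpact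
  split_ifs with hI
  · have hI' := thePoint_mem hI
    set I := thePoint (focus a b a' b') with hIdef
    obtain ⟨hIa, hIb⟩ := hI'
    rw [mem_affineSpan_pair_iff_exists_lineMap_eq] at hIa hIb
    obtain ⟨s, hs⟩ := hIa
    obtain ⟨r, hr⟩ := hIb
    have hs0 := congrArg (fun x : Plane => x 0) hs
    have hs1 := congrArg (fun x : Plane => x 1) hs
    have hr0 := congrArg (fun x : Plane => x 0) hr
    have hr1 := congrArg (fun x : Plane => x 1) hr
    simp only [AffineMap.lineMap_apply, vsub_eq_sub, vadd_eq_add, PiLp.add_apply, PiLp.smul_apply,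
      PiLp.sub_apply, smul_eq_mul] at hs0 hs1 hr0 hr1
    simp only [cross, PiLp.sub_apply] at h1 h2 h3
    suffices hne : {x | x ∈ line[ℝ, p, I] ∧ x ∈ segment ℝ a' b'}.Nonempty from
      (thePoint_mem hne).2
    rcases h3 with h3 | ⟨τ, h3, h4⟩
    · refine ⟨a', ?_, left_mem_segment ℝ a' b'⟩
      have : s = 1 := by
        subst h3
        have hz : (s - 1) * ((b 0 - a 0) * (a' 1 - a 1) - (b 1 - a 1) * (a' 0 - a 0)) = 0 := by
          linear_combination (b 1 - a' 1) * (hr0 - hs0) - (b 0 - a' 0) * (hr1 - hs1)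
        rcases mul_eq_zero.1 hz with h | h
        · linarith
        · rw [h] at h1; simp at h1
      subst this
      rw [AffineMap.lineMap_apply_one] at hs
      rw [hs]
      exact right_mem_affineSpan_pair ℝ p I
    · obtain ⟨D, hD⟩ : ∃ D, D = (a' 0 - a 0) * (b' 1 - b 1) - (a' 1 - a 1) * (b' 0 - b 0) :=
        ⟨_, rfl⟩
      have e1 : (b 0 - a 0) * (a' 1 - a 1) - (b 1 - a 1) * (a' 0 - a 0) = r * D := by
        rw [hD]; linear_combination (a' 1 - a 1) * (hr0 - hs0) - (a' 0 - a 0) * (hr1 - hs1)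
      have e2 : (b 0 - a 0) * (b' 1 - b 1) - (b 1 - a 1) * (b' 0 - b 0) = s * D := by
        rw [hD]; linear_combination (b' 1 - b 1) * (hr0 - hs0) - (b' 0 - b 0) * (hr1 - hs1)
      have e3 : (b' 0 - a' 0) * (a 1 - a' 1) - (b' 1 - a' 1) * (a 0 - a' 0) = (1 - r) * D := by
        rw [hD] at e1 ⊢; linear_combination -e1
      have e4 : (b' 0 - a' 0) * (b 1 - b' 1) - (b' 1 - a' 1) * (b 0 - b' 0) = (1 - s) * D := by
        rw [hD] at e2 ⊢; linear_combination -e2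
      rw [e1] at h1
      rw [e2] at h2
      rw [e3] at h3
      rw [e4] at h4
      have hsr : 0 < s * r := by
        have : 0 < (s * r) * (σ * D) ^ 2 := by nlinarith [mul_pos h1 h2]
        exact pos_of_mul_pos_left this (sq_nonneg _)
      have hsr1 : 0 < (s - 1) * (r - 1) := by
        have : 0 < ((s - 1) * (r - 1)) * (τ * D) ^ 2 := by nlinarith [mul_pos h3 h4]
        exact pos_of_mul_pos_left this (sq_nonneg _)
      obtain ⟨A, hA⟩ : ∃ A, A = (s - 1) * r := ⟨_, rfl⟩
      obtain ⟨B, hB⟩ : ∃ B, B = (r - 1) * s := ⟨_, rfl⟩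
      have hAB : 0 < A * B := by rw [hA, hB]; nlinarith [mul_pos hsr hsr1]
      obtain ⟨⟨hl0, hl1⟩, hl⟩ := param_spec hp
      set l := param a b p
      have hkey : (1 - l) * B + l * A ≠ 0 ∧ l * A / ((1 - l) * B + l * A) ∈ Set.Icc (0 : ℝ) 1 := by
        rcases pos_and_pos_or_neg_and_neg_of_mul_pos hAB with ⟨hA0, hB0⟩ | ⟨hA0, hB0⟩
        · have h5 : 0 < (1 - l) * B + l * A := by
            rcases hl0.eq_or_lt with h | h
            · rw [← h]; simpa using hB0
            · have := mul_pos h hA0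
              have := mul_nonneg (sub_nonneg.2 hl1) hB0.le
              linarith
          have := mul_nonneg (sub_nonneg.2 hl1) hB0.le
          exact ⟨h5.ne', div_nonneg (mul_nonneg hl0 hA0.le) h5.le,
            (div_le_one h5).2 (by linarith)⟩
        · have h5 : (1 - l) * B + l * A < 0 := by
            rcases hl0.eq_or_lt with h | h
            · rw [← h]; simpa using hB0
            · have := mul_neg_of_pos_of_neg h hA0
              have := mul_nonpos_of_nonneg_of_nonpos (sub_nonneg.2 hl1) hB0.le
              linarith
          have := mul_nonpos_of_nonneg_of_nonpos (sub_nonneg.2 hl1) hB0.le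
          exact ⟨h5.ne, div_nonneg_of_nonpos (mul_nonpos_of_nonneg_of_nonpos hl0 hA0.le) h5.le,
            (div_le_one_of_neg h5).2 (by linarith)⟩
      obtain ⟨hΔ, hμ⟩ := hkey
      refine ⟨AffineMap.lineMap a' b' (l * A / ((1 - l) * B + l * A)), ?_,
        lineMap_mem_segment hμ⟩
      rw [mem_affineSpan_pair_iff_exists_lineMap_eq]
      refine ⟨1 - (s - 1) * (r - 1) / ((1 - l) * B + l * A), ?_⟩
      rw [hl]
      have c1 : ∀ x : Fin 2, s * (a' x - a x) + a x = I x := by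
        intro x; fin_cases x
        · exact hs0
        · exact hs1
      have c2 : ∀ x : Fin 2, r * (b' x - b x) + b x = I x := by
        intro x; fin_cases x
        · exact hr0
        · exact hr1
      ext x
      have d1 := c1 x
      have d2 := c2 x
      simp only [AffineMap.lineMap_apply, vsub_eq_sub, vadd_eq_add, PiLp.add_apply,
        PiLp.smul_apply, PiLp.sub_apply, smul_eq_mul]
      field_simp
      subst hA hB
      linear_combination (-(1 - l) * (r - 1)) * d1 - (l * (s - 1)) * d2
  · exact lineMap_mem_segment (param_spec hp).1

lemma impacts_zero {N : ℕ} (F : Chain N × Chain N) (t : ℝ) :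
    impacts F t 0 = AffineMap.lineMap (F.1 1) (F.2 1) t := rfl

lemma impacts_succ {N : ℕ} (F : Chain N × Chain N) (t : ℝ) (i : Fin N) :
    impacts F t i.succ = nextImpact (F.1 (midIdx i)) (F.2 (midIdx i)) (F.1 (nextIdx i))
      (F.2 (nextIdx i)) (impacts F t i.castSucc) := rfl

/-- Between two successive mirrors (or the last mirror and the focal plane) the end points of
each one lie on the same side of the other. -/
lemma next_side {N : ℕ} {F : Chain N × Chain N} (hP : F ∈ FaiscP N) (hR : Reflexion F)
    (i : Fin N) :
    F.1 (nextIdx i) = F.2 (nextIdx i) ∨ ∃ τ : ℝ,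
      0 < τ * cross (F.2 (nextIdx i) - F.1 (nextIdx i)) (F.1 (midIdx i) - F.1 (nextIdx i)) ∧
      0 < τ * cross (F.2 (nextIdx i) - F.1 (nextIdx i)) (F.2 (midIdx i) - F.2 (nextIdx i)) := by
  by_cases h : (i : ℕ) + 1 < N
  · right
    obtain ⟨τ, h1, h2, -, -⟩ := reflexion_cross hP hR ⟨i + 1, h⟩
    exact ⟨τ, h1, h2⟩
  · left
    have : nextIdx i = Fin.last (N + 1) := by
      ext; simp only [nextIdx, Fin.val_succ, Fin.val_last]; omega
    rw [this]; exact hP.2.2.2.1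

/-- The impact points of the `t`-polygonal chain lie on the mirrors. -/
lemma impacts_mem {N : ℕ} {F : Chain N × Chain N} (hP : F ∈ FaiscP N) (hR : Reflexion F)
    {t : ℝ} (ht : t ∈ Set.Icc (0 : ℝ) 1) (i : Fin (N + 1)) :
    impacts F t i ∈ segment ℝ (F.1 i.succ) (F.2 i.succ) := by
  induction i using Fin.induction with
  | zero => exact lineMap_mem_segment ht
  | succ i ih =>
    obtain ⟨σ, -, -, h3, h4⟩ := reflexion_cross hP hR i
    rw [impacts_succ]
    exact nextImpact_mem ih h3 h4 (next_side hP hR i)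

lemma tChain_mem {N : ℕ} {F : Chain N × Chain N} (hP : F ∈ FaiscP N) (hR : Reflexion F)
    {t : ℝ} (ht : t ∈ Set.Icc (0 : ℝ) 1) {k : Fin (N + 2)} (hk : k ≠ 0) :
    tChain F t k ∈ segment ℝ (F.1 k) (F.2 k) := by
  obtain ⟨i, rfl⟩ := Fin.exists_succ_eq.2 hk
  exact impacts_mem hP hR ht i

lemma half_mem : (1 / 2 : ℝ) ∈ Set.Icc (0 : ℝ) 1 := by constructor <;> norm_num

lemma tChain_half_one {N : ℕ} {F : Chain N × Chain N} (hP : F ∈ FaiscP N) :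
    tChain F (1 / 2) 1 = 0 := by
  have h : AffineMap.lineMap (F.1 1) (F.2 1) (1 / 2 : ℝ) = midpoint ℝ (F.1 1) (F.2 1) := by
    simp [midpoint]
  exact h.trans hP.2.2.2.2

lemma tChain_half_zero {N : ℕ} {F : Chain N × Chain N} (hP : F ∈ FaiscP N) :
    tChain F (1 / 2) 0 = F.1 0 := by
  have h : tChain F (1 / 2) 0 = tChain F (1 / 2) 1 + F.1 0 := rfl
  rw [h, tChain_half_one hP, zero_add]

/-- All points of the centered polygonal chain lie on the mirrors (the source being `a₀ = b₀`). -/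
lemma tChain_half_mem {N : ℕ} {F : Chain N × Chain N} (hP : F ∈ FaiscP N) (hR : Reflexion F)
    (k : Fin (N + 2)) : tChain F (1 / 2) k ∈ segment ℝ (F.1 k) (F.2 k) := by
  by_cases hk : k = 0
  · subst hk
    rw [tChain_half_zero hP]
    exact left_mem_segment ℝ _ _
  · exact tChain_mem hP hR half_mem hk

/-- The neighbours of a point of the centered polygonal chain are on the same side of the mirror. -/
lemma centered_side {N : ℕ} {F : Chain N × Chain N} (hP : F ∈ FaiscP N) (hR : Reflexion F)
    (i : Fin N) : ∃ σ : ℝ,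
      0 < σ * cross (F.2 (midIdx i) - F.1 (midIdx i))
        (tChain F (1 / 2) (prevIdx i) - tChain F (1 / 2) (midIdx i)) ∧
      0 < σ * cross (F.2 (midIdx i) - F.1 (midIdx i))
        (tChain F (1 / 2) (nextIdx i) - tChain F (1 / 2) (midIdx i)) := by
  obtain ⟨σ, h1, h2, h3, h4⟩ := reflexion_cross hP hR i
  exact ⟨σ, side (tChain_half_mem hP hR _) (tChain_half_mem hP hR _) h1 h2,
    side (tChain_half_mem hP hR _) (tChain_half_mem hP hR _) h3 h4⟩

/-- The centered polygonal chain of a beam has no obscuration and no grazing. -/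
lemma centered_mem_LO {N : ℕ} {F : Chain N × Chain N} (hF : F ∈ Faisc N) :
    tChain F (1 / 2) ∈ LO N := by
  obtain ⟨hP, hO, hR⟩ := hF
  rintro (⟨j, ⟨k, hk0, hk1, hk2, hk⟩ | hj⟩ | ⟨i, hi⟩)
  · have := hO j _ half_mem k hk0 hk1 hk2
    exact Set.eq_empty_iff_forall_notMem.1 this _ ⟨hk, tChain_mem hP hR half_mem hk0⟩
  · by_cases h0 : j = 0
    · subst h0
      rw [ray, if_pos rfl] at hj
      refine Set.eq_empty_iff_forall_notMem.1 hj (tChain F (1 / 2) 1) ⟨?_, 0, le_rfl, by simp⟩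
      rw [tChain_half_one hP, tChain_half_zero hP, hP.2.1]
      intro h
      have := congrArg (fun x : Plane => x 0) h
      simp at this
    · rw [ray, if_neg h0] at hj
      exact Set.eq_empty_iff_forall_notMem.1 hj _ (left_mem_segment ℝ _ _)
  · obtain ⟨σ, h1, h2⟩ := centered_side hP hR i
    obtain ⟨r, s, hr, hs, hrs, h⟩ := hi
    have h0 := congrArg (fun x : Plane => x 0) h
    have h1' := congrArg (fun x : Plane => x 1) h
    simp only [PiLp.add_apply, PiLp.smul_apply, smul_eq_mul] at h0 h1'
    simp only [cross, PiLp.sub_apply] at h1 h2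
    obtain rfl : r = 1 - s := by linarith
    have e := add_pos (mul_pos hr h1) (mul_pos hs h2)
    refine absurd e (not_lt.2 (le_of_eq ?_))
    linear_combination
      σ * (F.2 (midIdx i) 0 - F.1 (midIdx i) 0) * h1' -
      σ * (F.2 (midIdx i) 1 - F.1 (midIdx i) 1) * h0

lemma norm_mul_cos_angle {x : Plane} (hx : x ≠ 0) : ∃ r : ℝ, 0 < r ∧
    x 0 = r * (angle x).cos ∧ x 1 = r * (angle x).sin := by
  have hz : (⟨x 0, x 1⟩ : ℂ) ≠ 0 := by
    intro h
    apply hx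
    ext i
    fin_cases i
    · exact congrArg Complex.re h
    · exact congrArg Complex.im h
  refine ⟨‖(⟨x 0, x 1⟩ : ℂ)‖, norm_pos_iff.2 hz, ?_, ?_⟩
  · rw [angle, Real.Angle.cos_coe, Complex.norm_mul_cos_arg]
  · rw [angle, Real.Angle.sin_coe, Complex.norm_mul_sin_arg]

lemma inner_normalOfAngle (x : Plane) (θ : Real.Angle) :
    inner ℝ x (normalOfAngle θ) = x 1 * θ.cos - x 0 * θ.sin := by
  simp only [inner_plane, normalOfAngle, Matrix.cons_val_zero, Matrix.cons_val_one]
  ring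

/-- The centered polygonal chain together with the directions of the mirrors is reflexive. -/
lemma reflexiveChain_mem_LR {N : ℕ} {F : Chain N × Chain N} (hF : F ∈ Faisc N) :
    (tChain F (1 / 2), fun j => angle (F.1 (midIdx j) - F.2 (midIdx j))) ∈ LR N := by
  refine ⟨centered_mem_LO hF, fun j => ?_⟩
  obtain ⟨σ, h1, h2⟩ := centered_side hF.1 hF.2.2 j
  obtain ⟨r, hr, e0, e1⟩ := norm_mul_cos_angle (sub_ne_zero.2 (hF.1.1 j))
  simp only [inner_normalOfAngle]
  set θ := angle (F.1 (midIdx j) - F.2 (midIdx j))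
  set u := tChain F (1 / 2) (prevIdx j) - tChain F (1 / 2) (midIdx j)
  set v := tChain F (1 / 2) (nextIdx j) - tChain F (1 / 2) (midIdx j)
  have key : ∀ w : Plane, σ * cross (F.2 (midIdx j) - F.1 (midIdx j)) w =
      (-σ * r) * (w 1 * θ.cos - w 0 * θ.sin) := by
    intro w
    simp only [PiLp.sub_apply] at e0 e1
    simp only [cross, PiLp.sub_apply]
    linear_combination (-σ * w 1) * e0 + (σ * w 0) * e1
  rw [key] at h1 h2
  rcases pos_and_pos_or_neg_and_neg_of_mul_pos h1 with ⟨hs, hu⟩ | ⟨hs, hu⟩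
  · have hv := pos_of_mul_pos_right h2 hs.le
    rw [sign_pos hu, sign_pos hv]; simp
  · have hv := neg_of_mul_pos_right h2 hs.le
    rw [sign_neg hu, sign_neg hv]; simp

lemma mem_halfCircle_iff (α φ : Real.Angle) {ε : ℝ} (hε : ε = 1 ∨ ε = -1) :
    φ ∈ halfCircle α ε ↔ 0 < ε * (φ - α).sin := by
  constructor
  · rintro ⟨s, hs, rfl⟩
    rw [add_sub_cancel_left, Real.Angle.sin_coe]
    have := Real.sin_pos_of_mem_Ioo hs
    rcases hε with rfl | rfl <;> simpa using this
  · intro h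
    refine ⟨ε * (φ - α).toReal, ?_, ?_⟩
    · rw [← Real.Angle.sin_toReal] at h
      have h1 := Real.Angle.neg_pi_lt_toReal (φ - α)
      have h2 := Real.Angle.toReal_le_pi (φ - α)
      rcases hε with rfl | rfl
      · rw [one_mul] at h ⊢
        constructor
        · by_contra hc
          linarith [Real.sin_nonpos_of_nonpos_of_neg_pi_le (not_lt.1 hc) h1.le]
        · refine lt_of_le_of_ne h2 fun hc => ?_
          rw [hc, Real.sin_pi] at h; exact lt_irrefl _ h
      · rw [neg_one_mul] at h ⊢
        constructor
        · by_contra hc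
          linarith [Real.sin_nonneg_of_nonneg_of_le_pi (by linarith) h2]
        · linarith
    · have : ε * (ε * (φ - α).toReal) = (φ - α).toReal := by
        rcases hε with rfl | rfl <;> ring
      rw [this, Real.Angle.coe_toReal, add_sub_cancel]

lemma mem_halfCircle_angle {x : Plane} (hx : x ≠ 0) (φ : Real.Angle) {ε : ℝ}
    (hε : ε = 1 ∨ ε = -1) :
    φ ∈ halfCircle (angle x) ε ↔ 0 < ε * inner ℝ (-x) (normalOfAngle φ) := by
  obtain ⟨r, hr, e0, e1⟩ := norm_mul_cos_angle hx
  rw [mem_halfCircle_iff _ _ hε, inner_normalOfAngle, sub_eq_add_neg, Real.Angle.sin_add,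
    Real.Angle.sin_neg, Real.Angle.cos_neg]
  have : ε * ((-x : Plane) 1 * φ.cos - (-x : Plane) 0 * φ.sin) =
      r * (ε * (φ.sin * (angle x).cos + φ.cos * -(angle x).sin)) := by
    simp only [PiLp.neg_apply, e0, e1]; ring
  rw [this, mul_pos_iff_of_pos_left hr]

lemma neg_one_pow_eq (n : ℕ) : ((-1 : ℝ) ^ n = 1) ∨ ((-1 : ℝ) ^ n = -1) :=
  neg_one_pow_eq_or ℝ n

lemma LR_ne {N : ℕ} (L : LR N) (j : Fin N) :
    L.1.1 (midIdx j) - L.1.1 (prevIdx j) ≠ 0 ∧ L.1.1 (midIdx j) - L.1.1 (nextIdx j) ≠ 0 := by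
  obtain ⟨h1, h2⟩ := L.2.2 j
  constructor
  · intro h
    rw [← neg_sub, h] at h2
    simp at h2
  · intro h
    rw [← h1, ← neg_sub, h] at h2
    simp at h2

lemma LR_mem_pos_iff {N : ℕ} (L : LR N) (j : Fin N) (φ : Real.Angle) :
    φ ∈ posOrientation L.1.1 j ↔
      0 < (-1) ^ ((j : ℕ) + 1) *
        inner ℝ (L.1.1 (prevIdx j) - L.1.1 (midIdx j)) (normalOfAngle φ) ∧
      0 < (-1) ^ ((j : ℕ) + 1) *
        inner ℝ (L.1.1 (nextIdx j) - L.1.1 (midIdx j)) (normalOfAngle φ) := by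
  rw [posOrientation, Set.mem_inter_iff, mem_halfCircle_angle (LR_ne L j).1 _ (neg_one_pow_eq _),
    mem_halfCircle_angle (LR_ne L j).2 _ (neg_one_pow_eq _), neg_sub, neg_sub]

lemma LR_mem_neg_iff {N : ℕ} (L : LR N) (j : Fin N) (φ : Real.Angle) :
    φ ∈ negOrientation L.1.1 j ↔
      (-1) ^ ((j : ℕ) + 1) *
        inner ℝ (L.1.1 (prevIdx j) - L.1.1 (midIdx j)) (normalOfAngle φ) < 0 ∧
      (-1) ^ ((j : ℕ) + 1) *
        inner ℝ (L.1.1 (nextIdx j) - L.1.1 (midIdx j)) (normalOfAngle φ) < 0 := by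
  rw [negOrientation, Set.mem_inter_iff, mem_halfCircle_angle (LR_ne L j).1 _ (neg_one_pow_eq _),
    mem_halfCircle_angle (LR_ne L j).2 _ (neg_one_pow_eq _), neg_sub, neg_sub, pow_succ _ (j + 1),
    mul_neg_one, neg_mul, neg_mul, neg_pos, neg_pos]

lemma LR_pos_or_neg {N : ℕ} (L : LR N) (j : Fin N) :
    L.1.2 j ∈ posOrientation L.1.1 j ∨ L.1.2 j ∈ negOrientation L.1.1 j := by
  obtain ⟨h1, h2⟩ := L.2.2 j
  rw [LR_mem_pos_iff L, LR_mem_neg_iff L]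
  have hm := mul_pos_of_sign_eq h1 h2
  rcases pos_and_pos_or_neg_and_neg_of_mul_pos hm with ⟨ha, hb⟩ | ⟨ha, hb⟩ <;>
  rcases neg_one_pow_eq ((j : ℕ) + 1) with h | h <;> rw [h]
  · left; constructor <;> linarith
  · right; constructor <;> linarith
  · right; constructor <;> linarith
  · left; constructor <;> linarith

lemma LR_not_pos_and_neg {N : ℕ} (L : LR N) (j : Fin N) :
    ¬ (L.1.2 j ∈ posOrientation L.1.1 j ∧ L.1.2 j ∈ negOrientation L.1.1 j) := by
  rw [LR_mem_pos_iff L, LR_mem_neg_iff L]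
  rintro ⟨⟨h1, -⟩, h2, -⟩
  linarith

lemma lineMap_injective_of_ne {a b : Plane} (h : a ≠ b) {s t : ℝ}
    (hst : AffineMap.lineMap a b s = (AffineMap.lineMap a b t : Plane)) : s = t :=
  AffineMap.lineMap_injective ℝ h hst

/-- The impact point does not depend on the order of the two extreme rays. -/
lemma nextImpact_swap {a b a' b' p : Plane} (h : a ≠ b) (hp : p ∈ segment ℝ a b) :
    nextImpact b a b' a' p = nextImpact a b a' b' p := by
  have hf : focus b a b' a' = focus a b a' b' := by
    ext x; exact and_comm
  have hpar : param b a p = 1 - param a b p := by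
    apply lineMap_injective_of_ne h.symm
    rw [← (param_spec (segment_symm ℝ a b ▸ hp)).2, AffineMap.lineMap_apply_one_sub]
    exact (param_spec hp).2
  unfold nextImpact
  rw [hf, hpar, segment_symm ℝ b' a', AffineMap.lineMap_apply_one_sub]

lemma swap_mem_FaiscP {N : ℕ} {F : Chain N × Chain N} (hP : F ∈ FaiscP N) :
    F.swap ∈ FaiscP N := by
  obtain ⟨h1, h2, h3, h4, h5⟩ := hP
  refine ⟨fun k => (h1 k).symm, h3, h2, h4.symm, ?_⟩
  rw [midpoint_comm]; exact h5

lemma swap_reflexion {N : ℕ} {F : Chain N × Chain N} (hR : Reflexion F) :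
    Reflexion F.swap := by
  intro i
  have h := hR i
  have hn : unitNormal (F.2 (midIdx i)) (F.1 (midIdx i)) =
      -unitNormal (F.1 (midIdx i)) (F.2 (midIdx i)) := by
    ext x
    fin_cases x
    · simp only [unitNormal, norm_sub_rev (F.1 (midIdx i))]; simp; ring
    · simp only [unitNormal, norm_sub_rev (F.1 (midIdx i))]; simp; ring
  simp only [Prod.fst_swap, Prod.snd_swap, hn, inner_neg_right, Left.sign_neg, neg_inj] at h ⊢
  obtain ⟨h1, h2, h3, h4⟩ := h
  refine ⟨h1.symm, h1.trans (h2.trans h3), h3.symm, ?_⟩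
  rw [h3]
  have hs : ∀ s : SignType, s ≠ 0 → -s ≠ 0 := by decide
  exact hs _ h4

/-- The `t`-polygonal chain of the inverse beam is the `(1 - t)`-polygonal chain of the beam. -/
lemma tChain_swap {N : ℕ} {F : Chain N × Chain N} (hP : F ∈ FaiscP N) (hR : Reflexion F)
    {t : ℝ} (ht : t ∈ Set.Icc (0 : ℝ) 1) : tChain F.swap t = tChain F (1 - t) := by
  have ht' : 1 - t ∈ Set.Icc (0 : ℝ) 1 := ⟨by linarith [ht.2], by linarith [ht.1]⟩
  have hl : (AffineMap.lineMap (F.2 1) (F.1 1) t : Plane) =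
      AffineMap.lineMap (F.1 1) (F.2 1) (1 - t) := by
    rw [AffineMap.lineMap_apply_one_sub]
  have hi : ∀ i, impacts F.swap t i = impacts F (1 - t) i := by
    intro i
    induction i using Fin.induction with
    | zero => exact hl
    | succ i ih =>
      rw [impacts_succ, impacts_succ, ih]
      exact nextImpact_swap (hP.1 i) (impacts_mem hP hR ht' i.castSucc)
  funext k
  refine Fin.cases ?_ (fun i => hi i) k
  change (AffineMap.lineMap (F.2 1) (F.1 1) t : Plane) + F.2 0 =
    AffineMap.lineMap (F.1 1) (F.2 1) (1 - t) + F.1 0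
  rw [hl, hP.2.1, hP.2.2.1]

lemma tChain_swap_half {N : ℕ} {F : Chain N × Chain N} (hF : F ∈ Faisc N) :
    tChain F.swap (1 / 2) = tChain F (1 / 2) := by
  rw [tChain_swap hF.1 hF.2.2 half_mem]; norm_num

lemma swap_mem_Faisc {N : ℕ} {F : Chain N × Chain N} (hF : F ∈ Faisc N) :
    F.swap ∈ Faisc N := by
  refine ⟨swap_mem_FaiscP hF.1, ?_, swap_reflexion hF.2.2⟩
  intro j t ht k h0 h1 h2
  rw [tChain_swap hF.1 hF.2.2 ht, Prod.fst_swap, Prod.snd_swap, segment_symm]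
  exact hF.2.1 j _ ⟨by linarith [ht.2], by linarith [ht.1]⟩ k h0 h1 h2

/-! ### The invariants of a beam -/

/-- The centered polygonal chain of a beam. -/
def centered {N : ℕ} (F : Faisc N) : LO N := ⟨tChain F.1 (1 / 2), centered_mem_LO F.2⟩

/-- The reflexive polygonal chain of a beam, with the angles of the vectors `aⱼ - bⱼ`. -/
def reflexiveChain {N : ℕ} (F : Faisc N) : LR N :=
  ⟨(tChain F.1 (1 / 2), fun j => angle (F.1.1 (midIdx j) - F.1.2 (midIdx j))),
    reflexiveChain_mem_LR F.2⟩

/-- The nomenclature of a beam. -/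
def nomenclatureF {N : ℕ} (F : Faisc N) : ConnectedComponents (LO N) := nomenclature (centered F)

/-- The characteristic of a beam. -/
def carF {N : ℕ} (F : Faisc N) : Fin N → ℤˣ := car (reflexiveChain F)

/-- The signature of a beam, with values in `{-1, 1}^{N-1}`. -/
def signF {N : ℕ} (F : Faisc N) : Fin (N - 1) → ℤˣ :=
  fun k => if carF F ⟨k, by omega⟩ = carF F ⟨k + 1, by omega⟩ then 1 else -1

/-! ### Symmetrical beams -/

/-- The inverse beam `((bᵢ), (aᵢ))`. -/
def invBeam {N : ℕ} (F : Faisc N) : Faisc N := ⟨F.1.swap, swap_mem_Faisc F.2⟩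

/-- The action of `ℤ/2ℤ` on beams that swaps the two polygonal chains. -/
instance (N : ℕ) : AddAction (ZMod 2) (Faisc N) where
  vadd g F := if g = 0 then F else invBeam F
  zero_vadd F := if_pos rfl
  add_vadd g h F := by
    have key : ∀ g : ZMod 2, g = 0 ∨ g = 1 := by decide
    have hinv : invBeam (invBeam F) = F := rfl
    change (if g + h = 0 then F else invBeam F) =
      (if g = 0 then (if h = 0 then F else invBeam F) else invBeam (if h = 0 then F else invBeam F))
    rcases key g with rfl | rfl <;> rcases key h with rfl | rfl
    · simp
    · simp
    · simp
    · rw [if_pos (by decide), if_neg (by decide), if_neg (by decide), hinv]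

/-- The space of symmetrical beams, with the quotient topology. -/
abbrev FaiscSym (N : ℕ) : Type := Quotient (AddAction.orbitRel (ZMod 2) (Faisc N))

lemma centered_inv {N : ℕ} (F : Faisc N) : centered (invBeam F) = centered F :=
  Subtype.ext (tChain_swap_half F.2)

lemma nomenclatureF_inv {N : ℕ} (F : Faisc N) : nomenclatureF (invBeam F) = nomenclatureF F := by
  rw [nomenclatureF, centered_inv, nomenclatureF]

lemma angle_neg_add_pi {x : Plane} (hx : x ≠ 0) :
    normalOfAngle (angle (-x)) = -normalOfAngle (angle x) := by
  obtain ⟨r, hr, e0, e1⟩ := norm_mul_cos_angle hx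
  obtain ⟨s, hs, f0, f1⟩ := norm_mul_cos_angle (neg_ne_zero.2 hx)
  simp only [PiLp.neg_apply] at f0 f1
  have hc := (angle x).cos_sq_add_sin_sq
  have hc' := (angle (-x)).cos_sq_add_sin_sq
  have hrs : r = s := by
    have : r ^ 2 = s ^ 2 := by
      have h1 : r ^ 2 = x 0 ^ 2 + x 1 ^ 2 := by rw [e0, e1]; linear_combination -r ^ 2 * hc
      have h2 : s ^ 2 = (-x 0) ^ 2 + (-x 1) ^ 2 := by rw [f0, f1]; linear_combination -s ^ 2 * hc'
      rw [h1, h2]; ring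
    exact (pow_left_inj₀ hr.le hs.le two_ne_zero).1 this
  subst hrs
  have g0 : (angle (-x)).cos = -(angle x).cos := by
    apply mul_left_cancel₀ hr.ne'; linarith
  have g1 : (angle (-x)).sin = -(angle x).sin := by
    apply mul_left_cancel₀ hr.ne'; linarith
  ext i
  fin_cases i <;> simp [normalOfAngle, g0, g1]

/-- Inverting a beam changes the sign of its characteristic. -/
lemma carF_inv {N : ℕ} (F : Faisc N) (j : Fin N) : carF (invBeam F) j = -carF F j := by
  have hc : (reflexiveChain (invBeam F)).1.1 = (reflexiveChain F).1.1 := tChain_swap_half F.2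
  have hn : normalOfAngle ((reflexiveChain (invBeam F)).1.2 j) =
      -normalOfAngle ((reflexiveChain F).1.2 j) := by
    have h := angle_neg_add_pi (sub_ne_zero.2 (F.2.1.1 j))
    rw [neg_sub] at h
    exact h
  have e : (reflexiveChain (invBeam F)).1.2 j ∈ posOrientation (reflexiveChain (invBeam F)).1.1 j ↔
      (reflexiveChain F).1.2 j ∈ negOrientation (reflexiveChain F).1.1 j := by
    rw [LR_mem_pos_iff, LR_mem_neg_iff, hc, hn]
    simp only [inner_neg_right, mul_neg, neg_pos]
  have h1 := LR_pos_or_neg (reflexiveChain F) j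
  have h2 := LR_not_pos_and_neg (reflexiveChain F) j
  unfold carF car
  by_cases hp : (reflexiveChain F).1.2 j ∈ posOrientation (reflexiveChain F).1.1 j
  · rw [if_pos hp, if_neg fun h => h2 ⟨hp, e.1 h⟩]
  · rw [if_neg hp, if_pos (e.2 (h1.resolve_left hp)), neg_neg]

lemma signF_inv {N : ℕ} (F : Faisc N) : signF (invBeam F) = signF F := by
  funext k
  simp only [signF, carF_inv, neg_inj]

lemma eq_of_orbitRel {N : ℕ} {B : Type*} (f : Faisc N → B) (hf : ∀ F, f (invBeam F) = f F)
    {F F' : Faisc N} (h : AddAction.orbitRel (ZMod 2) (Faisc N) F F') : f F = f F' := by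
  obtain ⟨g, rfl⟩ := h
  change f (if g = 0 then F' else (invBeam F')) = f F'
  split_ifs
  · rfl
  · exact hf F'

/-- The nomenclature of a symmetrical beam. -/
def nomenclatureS {N : ℕ} : FaiscSym N → ConnectedComponents (LO N) :=
  Quotient.lift nomenclatureF fun _ _ h => eq_of_orbitRel nomenclatureF nomenclatureF_inv h

/-- The signature of a symmetrical beam. -/
def signS {N : ℕ} : FaiscSym N → (Fin (N - 1) → ℤˣ) :=
  Quotient.lift signF fun _ _ h => eq_of_orbitRel signF signF_inv h

/-- The invariant of symmetrical beams. -/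
def invariantS {N : ℕ} (F : FaiscSym N) : ConnectedComponents (LO N) × (Fin (N - 1) → ℤˣ) :=
  (nomenclatureS F, signS F)

/-- A topological invariant takes the same value at the two ends of every continuous path. -/
def IsTopologicalInvariant {E B : Type*} [TopologicalSpace E] (I : E → B) : Prop :=
  ∀ X Y : E, Joined X Y → I X = I Y

/-- A topological invariant is exact if points with the same value are joined by a path. -/
def IsExactInvariant {E B : Type*} [TopologicalSpace E] (I : E → B) : Prop :=
  IsTopologicalInvariant I ∧ ∀ X Y : E, I X = I Y → Joined X Y

end OpticalBeam

end

/-! The invariant is constant on connected components because it is continuous with values in a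
totally disconnected space. The delicate point is the continuity of the centered chain, which is
defined by a choice of points and by a distinction between secant and parallel rays. In the segment
parameters, the passage from one mirror to the next is a projective map `mob K` of `[0, 1]` fixing
both ends, where `K > 0` is a quotient of products of cross products (`nextImpact_eq`). These maps
compose by multiplying the ratios, whence one closed formula for every impact point (`impacts_eq`).

Conversely, every beam contracts to a thin one. It is first narrowed to the rays of parameter close
to `1/2` (`joinedIn_subBeam`), then moved along a straight segment inside a convex set of shrunk
mirrors (`eventually_joinedIn_thinBeam_directions`). A thin beam amounts to a normalized chain in
`LO N`, a direction for each mirror and a small size: since `LO N` is open, small mirrors obscure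
nothing (`mem_Faisc_of_ball`).

Over a given chain, the directions of prescribed signs form a convex set, which contains suitably
signed exterior bisectors depending continuously on the chain. Hence a path of chains lifts to a
path of chains with directions (`joinedIn_Directed`), and by compactness one mirror size suits the
whole path (`eventually_joinedIn_thinBeam`). Components of the open set `LO N` are path connected,
so nomenclature and characteristic determine the path component of a beam. The signature gives the
characteristic up to a global sign, and exchanging the two extreme chains realizes that sign. -/

noncomputable section

namespace OpticalBeam

open Filter Topology

/-! ### Projective maps of the unit interval. -/

/-- The projective map of `[0, 1]` that multiplies the ratio `t / (1 - t)` by `K`. -/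
def mob (K t : ℝ) : ℝ := t * K / ((1 - t) + t * K)

lemma mob_den_pos {K t : ℝ} (hK : 0 < K) (ht : t ∈ Set.Icc (0 : ℝ) 1) :
    0 < (1 - t) + t * K := by
  rcases ht.1.eq_or_lt with rfl | h
  · simp
  · nlinarith [mul_pos h hK, ht.2]

lemma mob_mem {K t : ℝ} (hK : 0 < K) (ht : t ∈ Set.Icc (0 : ℝ) 1) :
    mob K t ∈ Set.Icc (0 : ℝ) 1 := by
  have h := mob_den_pos hK ht
  exact ⟨div_nonneg (mul_nonneg ht.1 hK.le) h.le, (div_le_one h).2 (by linarith [ht.2])⟩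

lemma mob_zero (K : ℝ) : mob K 0 = 0 := by simp [mob]

lemma mob_one {K : ℝ} (hK : 0 < K) : mob K 1 = 1 := by
  simp [mob, hK.ne']

lemma one_mob (t : ℝ) : mob 1 t = t := by simp [mob]

lemma mob_sub {K s t : ℝ} (hK : 0 < K) (hs : s ∈ Set.Icc (0 : ℝ) 1) (ht : t ∈ Set.Icc (0 : ℝ) 1) :
    mob K t - mob K s = K * (t - s) / (((1 - s) + s * K) * ((1 - t) + t * K)) := by
  have h1 := (mob_den_pos hK hs).ne'
  have h2 := (mob_den_pos hK ht).ne'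
  rw [mob, mob, div_sub_div _ _ h2 h1, div_eq_div_iff (mul_ne_zero h2 h1) (mul_ne_zero h1 h2)]
  ring

lemma mob_lt {K s t : ℝ} (hK : 0 < K) (hs : s ∈ Set.Icc (0 : ℝ) 1) (ht : t ∈ Set.Icc (0 : ℝ) 1)
    (hst : s < t) : mob K s < mob K t := by
  rw [← sub_pos, mob_sub hK hs ht]
  exact div_pos (mul_pos hK (sub_pos.2 hst)) (mul_pos (mob_den_pos hK hs) (mob_den_pos hK ht))

/-- This relation between denominators makes ratios telescope in `totalRatio_subBeam`. -/
lemma mob_den_mul {K κ t : ℝ} (hK : 0 < K) (ht : t ∈ Set.Icc (0 : ℝ) 1) :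
    (1 - mob K t) + mob K t * κ = ((1 - t) + t * (K * κ)) / ((1 - t) + t * K) := by
  have h1 := (mob_den_pos hK ht).ne'
  unfold mob
  field_simp
  ring

lemma mob_mob {K κ t : ℝ} (hK : 0 < K) (hκ : 0 < κ) (ht : t ∈ Set.Icc (0 : ℝ) 1) :
    mob κ (mob K t) = mob (K * κ) t := by
  have h1 := (mob_den_pos hK ht).ne'
  have h2 := (mob_den_pos (mul_pos hK hκ) ht).ne'
  conv_lhs => rw [mob, mob_den_mul hK ht]
  unfold mob
  field_simp

/-- The restriction of a projective map to a subinterval. -/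
lemma lineMap_mob {K t₁ t₂ t : ℝ} (hK : 0 < K) (h₁ : t₁ ∈ Set.Icc (0 : ℝ) 1)
    (h₂ : t₂ ∈ Set.Icc (0 : ℝ) 1) (ht : t ∈ Set.Icc (0 : ℝ) 1) :
    AffineMap.lineMap (mob K t₁) (mob K t₂)
        (mob (((1 - t₂) + t₂ * K) / ((1 - t₁) + t₁ * K)) t) =
      mob K (AffineMap.lineMap t₁ t₂ t) := by
  have d1 := (mob_den_pos hK h₁).ne'
  have d2 := (mob_den_pos hK h₂).ne'
  have e3 : AffineMap.lineMap t₁ t₂ t = t * (t₂ - t₁) + t₁ := by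
    simp [AffineMap.lineMap_apply]
  have h3 : t * (t₂ - t₁) + t₁ ∈ Set.Icc (0 : ℝ) 1 := by
    obtain ⟨p0, p1⟩ := h₁
    obtain ⟨q0, q1⟩ := h₂
    obtain ⟨r0, r1⟩ := ht
    constructor <;> nlinarith
  have d3 := (mob_den_pos hK h3).ne'
  rw [AffineMap.lineMap_apply, vsub_eq_sub, vadd_eq_add, smul_eq_mul, mob_sub hK h₁ h₂, e3]
  obtain ⟨D₁, hD₁⟩ : ∃ D, D = (1 - t₁) + t₁ * K := ⟨_, rfl⟩
  obtain ⟨D₂, hD₂⟩ : ∃ D, D = (1 - t₂) + t₂ * K := ⟨_, rfl⟩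
  obtain ⟨D, hD⟩ : ∃ D, D = (1 - (t * (t₂ - t₁) + t₁)) + (t * (t₂ - t₁) + t₁) * K := ⟨_, rfl⟩
  have e : (1 - t) + t * (D₂ / D₁) = D / D₁ := by
    rw [← hD₁] at d1
    field_simp
    rw [hD₁, hD₂, hD]
    ring
  rw [← hD₁] at d1
  rw [← hD₂] at d2
  rw [← hD] at d3
  rw [mob, mob, mob, ← hD₁, ← hD₂, ← hD, e]
  field_simp
  rw [hD₁, hD]
  ring

/-! ### Pencils of rays between two segments. -/

/-- The ratio of the projective map from `[a, b]` to `[a', b']` that a pencil of rays defines. -/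
def pencilRatio (a b a' b' : Plane) : ℝ :=
  (cross (b - a) (a' - a) * cross (b' - a') (b - b')) /
    (cross (b - a) (b' - b) * cross (b' - a') (a - a'))

lemma pencilRatio_pos {a b a' b' : Plane} {σ τ : ℝ}
    (h1 : 0 < σ * cross (b - a) (a' - a)) (h2 : 0 < σ * cross (b - a) (b' - b))
    (h3 : 0 < τ * cross (b' - a') (a - a')) (h4 : 0 < τ * cross (b' - a') (b - b')) :
    0 < pencilRatio a b a' b' := by
  have hσ : σ ≠ 0 := by rintro rfl; simp at h1
  have hτ : τ ≠ 0 := by rintro rfl; simp at h3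
  have : pencilRatio a b a' b' =
      (σ * cross (b - a) (a' - a)) * (τ * cross (b' - a') (b - b')) /
      ((σ * cross (b - a) (b' - b)) * (τ * cross (b' - a') (a - a'))) := by
    rw [pencilRatio, mul_mul_mul_comm, mul_mul_mul_comm σ (cross (b - a) (b' - b)),
      mul_div_mul_left _ _ (mul_ne_zero hσ hτ)]
  rw [this]
  positivity

/-- Both products are twice the same signed area, that of the triangle with vertices `a`, `b` and
the focus `I`; this excludes `s = 0` or `r = 0` in `nextImpact_eq`. -/
lemma cross_focus {a b a' b' I : Plane} {s r : ℝ} (hs : AffineMap.lineMap a a' s = I)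
    (hr : AffineMap.lineMap b b' r = I) :
    s * cross (b - a) (a' - a) = cross (b - I) (I - a) ∧
    r * cross (b - a) (b' - b) = cross (b - I) (I - a) := by
  subst hs
  have h0 := congrArg (fun x : Plane => x 0) hr
  have h1 := congrArg (fun x : Plane => x 1) hr
  simp only [AffineMap.lineMap_apply, vsub_eq_sub, vadd_eq_add, PiLp.add_apply, PiLp.smul_apply,
      PiLp.sub_apply, smul_eq_mul, cross] at h0 h1 ⊢
  constructor
  · ring
  · linear_combination (b 0 - a 0) * h1 - (b 1 - a 1) * h0

/-- With the origin at `I`, the end points are `-k a` and `-k' b`; the weight is chosen so that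
their barycenter is a multiple of `(1 - l) a + l b`. The homothety factor is `-k k' / ((1 - l) k' +
l k)`. -/
lemma pencil_point {a b I : Plane} {k k' l : ℝ} (h : (1 - l) * k' + l * k ≠ 0) :
    (AffineMap.lineMap (I - k • (a - I)) (I - k' • (b - I))
        (l * k / ((1 - l) * k' + l * k)) : Plane) =
      AffineMap.lineMap (AffineMap.lineMap a b l : Plane) I
        (1 + k * k' / ((1 - l) * k' + l * k)) := by
  ext x
  simp only [AffineMap.lineMap_apply, vsub_eq_sub, vadd_eq_add, PiLp.add_apply, PiLp.smul_apply,
      PiLp.sub_apply, smul_eq_mul]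
  field_simp
  ring

/-- The vectors `a - I` and `b - I` are independent, so taking the cross product with `(1 - l) (a -
I) + l (b - I)` eliminates `c` and leaves a linear equation for `m`. -/
lemma pencil_point_unique {a b I : Plane} {k k' l m c : ℝ} (h : (1 - l) * k' + l * k ≠ 0)
    (hAB : cross (a - I) (b - I) ≠ 0)
    (hm : (AffineMap.lineMap (I - k • (a - I)) (I - k' • (b - I)) m : Plane) =
      AffineMap.lineMap (AffineMap.lineMap a b l : Plane) I c) :
    m = l * k / ((1 - l) * k' + l * k) := by
  have h0 := congrArg (fun x : Plane => x 0) hm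
  have h1 := congrArg (fun x : Plane => x 1) hm
  simp only [AffineMap.lineMap_apply, vsub_eq_sub, vadd_eq_add, PiLp.add_apply, PiLp.smul_apply,
      PiLp.sub_apply, smul_eq_mul, cross] at h0 h1 hAB
  rw [eq_div_iff h]
  apply mul_right_cancel₀ hAB
  linear_combination ((1 - l) * (a 1 - I 1) + l * (b 1 - I 1)) * h0 -
    ((1 - l) * (a 0 - I 0) + l * (b 0 - I 0)) * h1

/-- The impact point on `[a', b']`, when the extreme rays meet or not. -/
lemma nextImpact_eq {a b a' b' : Plane} {σ τ l : ℝ} (hl : l ∈ Set.Icc (0 : ℝ) 1)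
    (h1 : 0 < σ * cross (b - a) (a' - a)) (h2 : 0 < σ * cross (b - a) (b' - b))
    (h3 : 0 < τ * cross (b' - a') (a - a')) (h4 : 0 < τ * cross (b' - a') (b - b')) :
    nextImpact a b a' b' (AffineMap.lineMap a b l) =
      AffineMap.lineMap a' b' (mob (pencilRatio a b a' b') l) := by
  have hab : a ≠ b := by rintro rfl; simp [cross] at h1
  have hκ := pencilRatio_pos h1 h2 h3 h4
  have n1 : cross (b - a) (a' - a) ≠ 0 := right_ne_zero_of_mul h1.ne'
  have n2 : cross (b - a) (b' - b) ≠ 0 := right_ne_zero_of_mul h2.ne'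
  have n3 : cross (b' - a') (a - a') ≠ 0 := right_ne_zero_of_mul h3.ne'
  by_cases hI : (focus a b a' b').Nonempty
  · rw [nextImpact, if_pos hI]
    have hI' := thePoint_mem hI
    generalize thePoint (focus a b a' b') = I at hI' ⊢
    obtain ⟨hIa, hIb⟩ := hI'
    rw [mem_affineSpan_pair_iff_exists_lineMap_eq] at hIa hIb
    obtain ⟨s, hs⟩ := hIa
    obtain ⟨r, hr⟩ := hIb
    obtain ⟨f1, f2⟩ := cross_focus hs hr
    have hs0 : s ≠ 0 := by
      rintro rfl
      have : a = I := by simpa using hs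
      subst this
      rw [sub_self, show cross (b - a) 0 = 0 by simp [cross]] at f2
      rcases mul_eq_zero.1 f2 with h | h
      · subst h
        exact hab (by simpa using hr.symm)
      · exact n2 h
    have hr0 : r ≠ 0 := by
      rintro rfl
      have : b = I := by simpa using hr
      rw [zero_mul] at f2
      rw [← f2] at f1
      exact (mul_ne_zero hs0 n1) f1
    have ha' : a' = I - ((1 - s) / s) • (a - I) := by
      rw [← hs]
      ext x
      simp only [AffineMap.lineMap_apply, vsub_eq_sub, vadd_eq_add, PiLp.add_apply,
        PiLp.smul_apply, PiLp.sub_apply, smul_eq_mul]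
      field_simp
      ring
    have hb' : b' = I - ((1 - r) / r) • (b - I) := by
      rw [← hr]
      ext x
      simp only [AffineMap.lineMap_apply, vsub_eq_sub, vadd_eq_add, PiLp.add_apply,
        PiLp.smul_apply, PiLp.sub_apply, smul_eq_mul]
      field_simp
      ring
    have hAB : cross (a - I) (b - I) ≠ 0 := by
      have : cross (a - I) (b - I) = cross (b - I) (I - a) := by
        simp only [cross, PiLp.sub_apply]; ring
      rw [this, ← f1]
      exact mul_ne_zero hs0 n1
    generalize (1 - s) / s = k at ha'
    generalize (1 - r) / r = k' at hb'
    have e1 : cross (b - a) (a' - a) = (1 + k) * cross (a - I) (b - I) := by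
      rw [ha']; simp only [cross, PiLp.sub_apply, PiLp.smul_apply, smul_eq_mul]; ring
    have e2 : cross (b - a) (b' - b) = (1 + k') * cross (a - I) (b - I) := by
      rw [hb']; simp only [cross, PiLp.sub_apply, PiLp.smul_apply, smul_eq_mul]; ring
    have e3 : cross (b' - a') (a - a') = (1 + k) * k' * cross (a - I) (b - I) := by
      rw [ha', hb']; simp only [cross, PiLp.sub_apply, PiLp.smul_apply, smul_eq_mul]; ring
    have e4 : cross (b' - a') (b - b') = (1 + k') * k * cross (a - I) (b - I) := by
      rw [ha', hb']; simp only [cross, PiLp.sub_apply, PiLp.smul_apply, smul_eq_mul]; ring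
    have hk' : k' ≠ 0 := by rintro rfl; simp [e3] at n3
    -- Relative to the focus, `a'` and `b'` are the images of `a` and `b` under homotheties of
    -- ratios `-k` and `-k'`; only the quotient of the two matters.
    have hkk : pencilRatio a b a' b' = k / k' := by
      rw [e1] at n1
      rw [e2] at n2
      have m1 := left_ne_zero_of_mul n1
      have m2 := left_ne_zero_of_mul n2
      rw [pencilRatio, e1, e2, e3, e4]
      field_simp
    have hΔ : (1 - l) * k' + l * k ≠ 0 := by
      have h := (mob_den_pos hκ hl).ne'
      rw [hkk] at h
      intro h0
      apply h
      field_simp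
      linarith
    have hmob : mob (pencilRatio a b a' b') l = l * k / ((1 - l) * k' + l * k) := by
      rw [mob, hkk, show (1 - l) + l * (k / k') = ((1 - l) * k' + l * k) / k' by field_simp]
      field_simp
    have hx : thePoint {x | x ∈ line[ℝ, AffineMap.lineMap a b l, I] ∧ x ∈ segment ℝ a' b'} ∈
        {x | x ∈ line[ℝ, AffineMap.lineMap a b l, I] ∧ x ∈ segment ℝ a' b'} := by
      refine thePoint_mem ⟨AffineMap.lineMap a' b' (mob (pencilRatio a b a' b') l), ?_,
        lineMap_mem_segment (mob_mem hκ hl)⟩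
      rw [mem_affineSpan_pair_iff_exists_lineMap_eq, hmob, ha', hb']
      exact ⟨_, (pencil_point hΔ).symm⟩
    generalize thePoint {x | x ∈ line[ℝ, AffineMap.lineMap a b l, I] ∧ x ∈ segment ℝ a' b'} = x
      at hx
    obtain ⟨hx1, hx2⟩ := hx
    rw [mem_affineSpan_pair_iff_exists_lineMap_eq] at hx1
    rw [segment_eq_image_lineMap] at hx2
    obtain ⟨c, hc⟩ := hx1
    obtain ⟨m, -, rfl⟩ := hx2
    rw [hmob]
    congr 1
    rw [ha', hb'] at hc
    exact pencil_point_unique hΔ hAB hc.symm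
  · rw [nextImpact, if_neg hI]
    have hpar := lineMap_injective_of_ne hab (param_spec (lineMap_mem_segment hl)).2
    -- Lines that do not meet are parallel: otherwise Cramer's rule gives their common point.
    -- Parallelism forces the ratio `1`, and `mob 1` is the identity, in agreement with the default
    -- value of `nextImpact`.
    have hD : cross (a' - a) (b' - b) = 0 := by
      by_contra hD
      refine hI ⟨AffineMap.lineMap a a' (cross (b - a) (b' - b) / cross (a' - a) (b' - b)), ?_, ?_⟩
      · rw [mem_affineSpan_pair_iff_exists_lineMap_eq]
        exact ⟨_, rfl⟩
      · rw [mem_affineSpan_pair_iff_exists_lineMap_eq]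
        refine ⟨cross (b - a) (a' - a) / cross (a' - a) (b' - b), ?_⟩
        ext x
        simp only [AffineMap.lineMap_apply, vsub_eq_sub, vadd_eq_add, PiLp.add_apply,
          PiLp.smul_apply, PiLp.sub_apply, smul_eq_mul]
        field_simp
        simp only [cross, PiLp.sub_apply]
        fin_cases x <;> simp only [Fin.zero_eta, Fin.mk_one] <;> ring
    have e3 : cross (b' - a') (a - a') = -cross (b - a) (a' - a) := by
      simp only [cross, PiLp.sub_apply] at hD ⊢
      linear_combination hD
    have e4 : cross (b' - a') (b - b') = -cross (b - a) (b' - b) := by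
      simp only [cross, PiLp.sub_apply] at hD ⊢
      linear_combination hD
    have : pencilRatio a b a' b' = 1 := by
      rw [pencilRatio, e3, e4, div_eq_one_iff_eq]
      · ring
      · exact mul_ne_zero n2 (neg_ne_zero.2 n1)
    rw [← hpar, this, one_mob]

/-- The ratio of a pencil for the restriction of the rays to a subinterval. -/
lemma pencilRatio_lineMap {a b a' b' : Plane} {σ τ l₁ l₂ : ℝ} (hl₁ : l₁ ∈ Set.Icc (0 : ℝ) 1)
    (hl₂ : l₂ ∈ Set.Icc (0 : ℝ) 1) (hl : l₁ < l₂)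
    (h1 : 0 < σ * cross (b - a) (a' - a)) (h2 : 0 < σ * cross (b - a) (b' - b))
    (h3 : 0 < τ * cross (b' - a') (a - a')) (h4 : 0 < τ * cross (b' - a') (b - b')) :
    pencilRatio (AffineMap.lineMap a b l₁) (AffineMap.lineMap a b l₂)
      (AffineMap.lineMap a' b' (mob (pencilRatio a b a' b') l₁))
      (AffineMap.lineMap a' b' (mob (pencilRatio a b a' b') l₂)) =
    ((1 - l₂) + l₂ * pencilRatio a b a' b') / ((1 - l₁) + l₁ * pencilRatio a b a' b') := by
  have hκ := pencilRatio_pos h1 h2 h3 h4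
  have n1 : cross (b - a) (a' - a) ≠ 0 := right_ne_zero_of_mul h1.ne'
  have n2 : cross (b - a) (b' - b) ≠ 0 := right_ne_zero_of_mul h2.ne'
  have n3 : cross (b' - a') (a - a') ≠ 0 := right_ne_zero_of_mul h3.ne'
  -- The cross product of the mirror direction with a ray does not depend on the starting point of
  -- the ray on the mirror, and is affine in its end point.
  have key : ∀ (p q r s : ℝ), cross (AffineMap.lineMap a b p - AffineMap.lineMap a b q)
      (AffineMap.lineMap a' b' r - AffineMap.lineMap a b s) =
      (p - q) * ((1 - r) * cross (b - a) (a' - a) + r * cross (b - a) (b' - b)) := by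
    intro p q r s
    simp only [AffineMap.lineMap_apply, vsub_eq_sub, vadd_eq_add, PiLp.add_apply,
      PiLp.smul_apply, PiLp.sub_apply, smul_eq_mul, cross]
    ring
  have key' : ∀ (p q r s : ℝ), cross (AffineMap.lineMap a' b' p - AffineMap.lineMap a' b' q)
      (AffineMap.lineMap a b r - AffineMap.lineMap a' b' s) =
      (p - q) * ((1 - r) * cross (b' - a') (a - a') + r * cross (b' - a') (b - b')) := by
    intro p q r s
    simp only [AffineMap.lineMap_apply, vsub_eq_sub, vadd_eq_add, PiLp.add_apply,
      PiLp.smul_apply, PiLp.sub_apply, smul_eq_mul, cross]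
    ring
  have hd₁ := (mob_den_pos hκ hl₁).ne'
  have hd₂ := (mob_den_pos hκ hl₂).ne'
  have hm := (sub_pos.2 (mob_lt hκ hl₁ hl₂ hl)).ne'
  have hl' := (sub_pos.2 hl).ne'
  have hcancel : ∀ p q x y z w : ℝ, p ≠ 0 → q ≠ 0 →
      p * x * (q * y) / (p * z * (q * w)) = x * y / (z * w) := by
    intro p q x y z w hp hq
    rw [mul_mul_mul_comm, mul_mul_mul_comm p z, mul_div_mul_left _ _ (mul_ne_zero hp hq)]
  rw [pencilRatio, key, key, key', key', hcancel _ _ _ _ _ _ hl' hm]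
  have hκdef : pencilRatio a b a' b' * (cross (b - a) (b' - b) * cross (b' - a') (a - a')) =
      cross (b - a) (a' - a) * cross (b' - a') (b - b') :=
    div_mul_cancel₀ _ (mul_ne_zero n2 n3)
  unfold mob
  generalize pencilRatio a b a' b' = κ at *
  generalize cross (b - a) (a' - a) = α at *
  generalize cross (b - a) (b' - b) = β at *
  generalize cross (b' - a') (a - a') = γ at *
  generalize cross (b' - a') (b - b') = δ at *
  have hκ' : κ = α * δ / (β * γ) := by rw [eq_div_iff (mul_ne_zero n2 n3), hκdef]
  -- Up to the constant `α / γ`, the cross product seen from the first mirror is the one seen from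
  -- the second, divided by the denominator of `mob κ l`. Only the denominators survive in the final
  -- quotient.
  have i1 : ∀ l : ℝ, (1 - l) + l * κ ≠ 0 →
      (1 - l * κ / ((1 - l) + l * κ)) * α + l * κ / ((1 - l) + l * κ) * β =
      α / γ * (((1 - l) * γ + l * δ) / ((1 - l) + l * κ)) := by
    intro l h
    rw [eq_comm, div_mul_div_comm, div_eq_iff (mul_ne_zero n3 h)]
    have : l * κ / ((1 - l) + l * κ) * ((1 - l) + l * κ) = l * κ := div_mul_cancel₀ _ h
    linear_combination (γ * α - γ * β) * this - l * hκdef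
  have i2 : ∀ l : ℝ, (1 - l) + l * κ ≠ 0 → l ∈ Set.Icc (0 : ℝ) 1 → (1 - l) * γ + l * δ ≠ 0 := by
    intro l _ hl h0
    have : 0 < (1 - l) * (τ * γ) + l * (τ * δ) := by
      rcases hl.1.eq_or_lt with rfl | h
      · simpa using h3
      · have := mul_nonneg (sub_nonneg.2 hl.2) h3.le
        have := mul_pos h h4
        linarith
    have e : (1 - l) * (τ * γ) + l * (τ * δ) = τ * ((1 - l) * γ + l * δ) := by ring
    rw [e, h0, mul_zero] at this
    exact lt_irrefl _ this
  have g1 := i2 l₁ hd₁ hl₁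
  have g2 := i2 l₂ hd₂ hl₂
  rw [i1 l₁ hd₁, i1 l₂ hd₂]
  generalize (1 - l₁) * γ + l₁ * δ = u at *
  generalize (1 - l₂) * γ + l₂ * δ = v at *
  generalize (1 - l₁) + l₁ * κ = u' at *
  generalize (1 - l₂) + l₂ * κ = v' at *
  field_simp

/-! ### Reflexion through cross products, and the explicit impact points. -/

lemma sign_eq_of_mul_pos {σ x y : ℝ} (hx : 0 < σ * x) (hy : 0 < σ * y) :
    SignType.sign x = SignType.sign y ∧ SignType.sign y ≠ 0 := by
  have hσ : σ ≠ 0 := by rintro rfl; simp at hx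
  have hy0 : y ≠ 0 := right_ne_zero_of_mul hy.ne'
  refine ⟨?_, sign_ne_zero.2 hy0⟩
  have h1 := sign_pos hx
  have h2 := sign_pos hy
  rw [sign_mul] at h1 h2
  have hs : SignType.sign σ ≠ 0 := sign_ne_zero.2 hσ
  exact mul_left_cancel₀ hs (h1.trans h2.symm)

/-- Converse of `reflexion_cross`. The form with a multiplier `σ` avoids unit normals and is stable
under convex combinations and small perturbations. -/
lemma reflexion_of_cross {N : ℕ} {F : Chain N × Chain N}
    (hne : ∀ k : Fin N, F.1 (midIdx k) ≠ F.2 (midIdx k))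
    (h : ∀ i : Fin N, ∃ σ : ℝ,
      0 < σ * cross (F.2 (midIdx i) - F.1 (midIdx i)) (F.1 (prevIdx i) - F.1 (midIdx i)) ∧
      0 < σ * cross (F.2 (midIdx i) - F.1 (midIdx i)) (F.2 (prevIdx i) - F.2 (midIdx i)) ∧
      0 < σ * cross (F.2 (midIdx i) - F.1 (midIdx i)) (F.1 (nextIdx i) - F.1 (midIdx i)) ∧
      0 < σ * cross (F.2 (midIdx i) - F.1 (midIdx i)) (F.2 (nextIdx i) - F.2 (midIdx i))) :
    Reflexion F := by
  intro i
  obtain ⟨σ, h1, h2, h3, h4⟩ := h i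
  simp only [sign_inner_unitNormal (hne i)]
  exact ⟨(sign_eq_of_mul_pos h1 h2).1, (sign_eq_of_mul_pos h2 h3).1, sign_eq_of_mul_pos h3 h4⟩

/-- Shrinking the mirrors of a beam preserves the reflexion condition. -/
lemma reflexion_of_subset {N : ℕ} {F G : Chain N × Chain N} (hP : F ∈ FaiscP N)
    (hR : Reflexion F) (h1 : ∀ k, G.1 k ∈ segment ℝ (F.1 k) (F.2 k))
    (h2 : ∀ k, G.2 k ∈ segment ℝ (F.1 k) (F.2 k))
    (hd : ∀ i : Fin N, ∃ r : ℝ, 0 < r ∧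
      G.2 (midIdx i) - G.1 (midIdx i) = r • (F.2 (midIdx i) - F.1 (midIdx i))) :
    Reflexion G := by
  have hsmul : ∀ (r : ℝ) (u v : Plane), cross (r • u) v = r * cross u v := by
    intro r u v
    simp only [cross, PiLp.smul_apply, smul_eq_mul]
    ring
  have hne : ∀ i : Fin N, G.1 (midIdx i) ≠ G.2 (midIdx i) := by
    intro i hi
    obtain ⟨r, hr, e⟩ := hd i
    rw [hi, sub_self] at e
    exact smul_ne_zero hr.ne' (sub_ne_zero.2 (hP.1 i).symm) e.symm
  refine reflexion_of_cross hne fun i => ?_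
  obtain ⟨r, hr, e⟩ := hd i
  obtain ⟨σ, q1, q2, q3, q4⟩ := reflexion_cross hP hR i
  refine ⟨σ, ?_⟩
  rw [e]
  simp only [hsmul, mul_left_comm σ r]
  exact ⟨mul_pos hr (side (h1 _) (h1 _) q1 q2), mul_pos hr (side (h2 _) (h2 _) q1 q2),
    mul_pos hr (side (h1 _) (h1 _) q3 q4), mul_pos hr (side (h2 _) (h2 _) q3 q4)⟩

/-- The ratio of the pencil of rays from the mirror `i + 1` to the next one (`1` if the next one
is the focal point). -/
def stepRatio {N : ℕ} (F : Chain N × Chain N) (i : Fin N) : ℝ :=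
  if (i : ℕ) + 1 < N then
    pencilRatio (F.1 (midIdx i)) (F.2 (midIdx i)) (F.1 (nextIdx i)) (F.2 (nextIdx i))
  else 1

/-- The ratio of the projective map from the first mirror to the mirror `i + 1`. -/
def totalRatio {N : ℕ} (F : Chain N × Chain N) (i : Fin (N + 1)) : ℝ :=
  Fin.induction (motive := fun _ => ℝ) 1 (fun i K => K * stepRatio F i) i

lemma totalRatio_zero {N : ℕ} (F : Chain N × Chain N) : totalRatio F 0 = 1 := rfl

lemma totalRatio_succ {N : ℕ} (F : Chain N × Chain N) (i : Fin N) :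
    totalRatio F i.succ = totalRatio F i.castSucc * stepRatio F i := rfl

/-- The sides of two successive mirrors. -/
lemma step_cross {N : ℕ} {F : Chain N × Chain N} (hP : F ∈ FaiscP N) (hR : Reflexion F)
    (i : Fin N) (hi : (i : ℕ) + 1 < N) : ∃ σ τ : ℝ,
      0 < σ * cross (F.2 (midIdx i) - F.1 (midIdx i)) (F.1 (nextIdx i) - F.1 (midIdx i)) ∧
      0 < σ * cross (F.2 (midIdx i) - F.1 (midIdx i)) (F.2 (nextIdx i) - F.2 (midIdx i)) ∧
      0 < τ * cross (F.2 (nextIdx i) - F.1 (nextIdx i)) (F.1 (midIdx i) - F.1 (nextIdx i)) ∧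
      0 < τ * cross (F.2 (nextIdx i) - F.1 (nextIdx i)) (F.2 (midIdx i) - F.2 (nextIdx i)) := by
  obtain ⟨σ, -, -, h3, h4⟩ := reflexion_cross hP hR i
  obtain ⟨τ, h1, h2, -, -⟩ := reflexion_cross hP hR ⟨i + 1, hi⟩
  exact ⟨σ, τ, h3, h4, h1, h2⟩

lemma stepRatio_pos {N : ℕ} {F : Chain N × Chain N} (hP : F ∈ FaiscP N) (hR : Reflexion F)
    (i : Fin N) : 0 < stepRatio F i := by
  unfold stepRatio
  split_ifs with hi
  · obtain ⟨σ, τ, h1, h2, h3, h4⟩ := step_cross hP hR i hi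
    exact pencilRatio_pos h1 h2 h3 h4
  · exact one_pos

lemma totalRatio_pos {N : ℕ} {F : Chain N × Chain N} (hP : F ∈ FaiscP N) (hR : Reflexion F)
    (i : Fin (N + 1)) : 0 < totalRatio F i := by
  induction i using Fin.induction with
  | zero => exact one_pos
  | succ i ih => exact mul_pos ih (stepRatio_pos hP hR i)

lemma nextIdx_eq_last {N : ℕ} {i : Fin N} (hi : ¬ (i : ℕ) + 1 < N) :
    nextIdx i = Fin.last (N + 1) := by
  ext; simp only [nextIdx, Fin.val_succ, Fin.val_last]; omega

/-- One step of the propagation of a ray. -/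
lemma nextImpact_step {N : ℕ} {F : Chain N × Chain N} (hP : F ∈ FaiscP N) (hR : Reflexion F)
    (i : Fin N) {l : ℝ} (hl : l ∈ Set.Icc (0 : ℝ) 1) :
    nextImpact (F.1 (midIdx i)) (F.2 (midIdx i)) (F.1 (nextIdx i)) (F.2 (nextIdx i))
      (AffineMap.lineMap (F.1 (midIdx i)) (F.2 (midIdx i)) l) =
    AffineMap.lineMap (F.1 (nextIdx i)) (F.2 (nextIdx i)) (mob (stepRatio F i) l) := by
  by_cases hi : (i : ℕ) + 1 < N
  · rw [stepRatio, if_pos hi]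
    obtain ⟨σ, τ, h1, h2, h3, h4⟩ := step_cross hP hR i hi
    exact nextImpact_eq hl h1 h2 h3 h4
  -- The last target segment is the single focal point, so the value of the ratio is irrelevant
  -- there.
  · obtain ⟨σ, -, -, h3, h4⟩ := reflexion_cross hP hR i
    have h := nextImpact_mem (lineMap_mem_segment hl) h3 h4 (next_side hP hR i)
    have he : F.1 (nextIdx i) = F.2 (nextIdx i) := by
      rw [nextIdx_eq_last hi]; exact hP.2.2.2.1
    rw [← he, segment_same, Set.mem_singleton_iff] at h
    rw [← he, h, AffineMap.lineMap_same_apply]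

/-- Each step is a map `mob` in the segment parameter, and composition multiplies the ratios. The
formula involves neither a choice nor a case distinction on the lines, so continuity and restriction
to subintervals can be read off it. -/
lemma impacts_eq {N : ℕ} {F : Chain N × Chain N} (hP : F ∈ FaiscP N) (hR : Reflexion F)
    {t : ℝ} (ht : t ∈ Set.Icc (0 : ℝ) 1) (i : Fin (N + 1)) :
    impacts F t i = AffineMap.lineMap (F.1 i.succ) (F.2 i.succ) (mob (totalRatio F i) t) := by
  induction i using Fin.induction with
  | zero => rw [totalRatio_zero, one_mob]; rfl
  | succ i ih =>
    have hK := totalRatio_pos hP hR i.castSucc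
    rw [impacts_succ, ih, totalRatio_succ, ← mob_mob hK (stepRatio_pos hP hR i) ht]
    exact nextImpact_step hP hR i (mob_mem hK ht)

/-! ### Sub-beams between two rays of a beam. -/

/-- The part of a beam between the `t₁`- and `t₂`-polygonal chains. -/
def subBeam {N : ℕ} (F : Chain N × Chain N) (t₁ t₂ : ℝ) : Chain N × Chain N :=
  (Fin.cons (!₂[-1, 0] : Plane) (impacts F t₁), Fin.cons (!₂[-1, 0] : Plane) (impacts F t₂))

lemma subBeam_sub {N : ℕ} {F : Chain N × Chain N} (hP : F ∈ FaiscP N) (hR : Reflexion F)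
    {t₁ t₂ : ℝ} (h₁ : t₁ ∈ Set.Icc (0 : ℝ) 1) (h₂ : t₂ ∈ Set.Icc (0 : ℝ) 1) (i : Fin (N + 1)) :
    (subBeam F t₁ t₂).2 i.succ - (subBeam F t₁ t₂).1 i.succ =
      (mob (totalRatio F i) t₂ - mob (totalRatio F i) t₁) • (F.2 i.succ - F.1 i.succ) := by
  change impacts F t₂ i - impacts F t₁ i = _
  rw [impacts_eq hP hR h₁, impacts_eq hP hR h₂]
  simp only [AffineMap.lineMap_apply, vsub_eq_sub, vadd_eq_add]
  module

lemma subBeam_mem {N : ℕ} {F : Chain N × Chain N} (hP : F ∈ FaiscP N) (hR : Reflexion F)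
    {t₁ t₂ : ℝ} (h₁ : t₁ ∈ Set.Icc (0 : ℝ) 1) (h₂ : t₂ ∈ Set.Icc (0 : ℝ) 1) (k : Fin (N + 2)) :
    (subBeam F t₁ t₂).1 k ∈ segment ℝ (F.1 k) (F.2 k) ∧
      (subBeam F t₁ t₂).2 k ∈ segment ℝ (F.1 k) (F.2 k) := by
  refine Fin.cases ?_ (fun i => ?_) k
  · rw [hP.2.1, hP.2.2.1, segment_same]
    exact ⟨rfl, rfl⟩
  · exact ⟨impacts_mem hP hR h₁ i, impacts_mem hP hR h₂ i⟩

lemma subBeam_mem_FaiscP {N : ℕ} {F : Chain N × Chain N} (hP : F ∈ FaiscP N) (hR : Reflexion F)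
    {t₁ t₂ : ℝ} (h₁ : t₁ ∈ Set.Icc (0 : ℝ) 1) (h₂ : t₂ ∈ Set.Icc (0 : ℝ) 1) (h : t₁ < t₂)
    (hs : t₁ + t₂ = 1) : subBeam F t₁ t₂ ∈ FaiscP N := by
  refine ⟨fun k hk => ?_, rfl, rfl, ?_, ?_⟩
  · have e := subBeam_sub hP hR h₁ h₂ k.castSucc
    rw [← midIdx, hk, sub_self] at e
    exact smul_ne_zero (sub_pos.2 (mob_lt (totalRatio_pos hP hR _) h₁ h₂ h)).ne'
      (sub_ne_zero.2 (hP.1 k).symm) e.symm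
  · have e := subBeam_sub hP hR h₁ h₂ (Fin.last N)
    rw [Fin.succ_last, hP.2.2.2.1, sub_self, smul_zero, sub_eq_zero] at e
    exact e.symm
  · have hm := hP.2.2.2.2
    change midpoint ℝ (AffineMap.lineMap (F.1 1) (F.2 1) t₁ : Plane)
      (AffineMap.lineMap (F.1 1) (F.2 1) t₂) = 0
    rw [← hm]
    -- The interval of parameters is symmetric about `1/2`, so the midpoint on the first mirror
    -- stays at the origin.
    obtain rfl : t₂ = 1 - t₁ := by linarith
    simp only [AffineMap.lineMap_apply, vsub_eq_sub, vadd_eq_add, midpoint_eq_smul_add]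
    module

lemma subBeam_reflexion {N : ℕ} {F : Chain N × Chain N} (hP : F ∈ FaiscP N) (hR : Reflexion F)
    {t₁ t₂ : ℝ} (h₁ : t₁ ∈ Set.Icc (0 : ℝ) 1) (h₂ : t₂ ∈ Set.Icc (0 : ℝ) 1) (h : t₁ < t₂) :
    Reflexion (subBeam F t₁ t₂) :=
  reflexion_of_subset hP hR (fun k => (subBeam_mem hP hR h₁ h₂ k).1)
    (fun k => (subBeam_mem hP hR h₁ h₂ k).2) fun i =>
      ⟨_, sub_pos.2 (mob_lt (totalRatio_pos hP hR _) h₁ h₂ h), subBeam_sub hP hR h₁ h₂ i.castSucc⟩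

lemma stepRatio_subBeam {N : ℕ} {F : Chain N × Chain N} (hP : F ∈ FaiscP N) (hR : Reflexion F)
    {t₁ t₂ : ℝ} (h₁ : t₁ ∈ Set.Icc (0 : ℝ) 1) (h₂ : t₂ ∈ Set.Icc (0 : ℝ) 1) (h : t₁ < t₂)
    (i : Fin N) : stepRatio (subBeam F t₁ t₂) i =
      ((1 - mob (totalRatio F i.castSucc) t₂) + mob (totalRatio F i.castSucc) t₂ * stepRatio F i) /
      ((1 - mob (totalRatio F i.castSucc) t₁) +
        mob (totalRatio F i.castSucc) t₁ * stepRatio F i) := by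
  have hK := totalRatio_pos hP hR i.castSucc
  by_cases hi : (i : ℕ) + 1 < N
  · have hκ := stepRatio_pos hP hR i
    have e : ∀ t ∈ Set.Icc (0 : ℝ) 1, impacts F t i.succ = AffineMap.lineMap (F.1 (nextIdx i))
        (F.2 (nextIdx i)) (mob (stepRatio F i) (mob (totalRatio F i.castSucc) t)) := by
      intro t ht
      rw [impacts_eq hP hR ht, totalRatio_succ, mob_mob hK hκ ht]
      rfl
    rw [stepRatio, if_pos hi]
    change pencilRatio (impacts F t₁ i.castSucc) (impacts F t₂ i.castSucc) (impacts F t₁ i.succ)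
      (impacts F t₂ i.succ) = _
    rw [e _ h₁, e _ h₂, impacts_eq hP hR h₁, impacts_eq hP hR h₂]
    obtain ⟨σ, τ, q1, q2, q3, q4⟩ := step_cross hP hR i hi
    have hst : stepRatio F i = pencilRatio (F.1 (midIdx i)) (F.2 (midIdx i)) (F.1 (nextIdx i))
      (F.2 (nextIdx i)) := if_pos hi
    rw [hst]
    exact pencilRatio_lineMap (mob_mem hK h₁) (mob_mem hK h₂) (mob_lt hK h₁ h₂ h) q1 q2 q3 q4
  · rw [stepRatio, stepRatio, if_neg hi, if_neg hi]
    simp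

/-- By `mob_den_mul`, each step contributes a quotient of consecutive denominators, at `t₂` and at
`t₁`; the product telescopes. The result is the ratio required by `lineMap_mob`. -/
lemma totalRatio_subBeam {N : ℕ} {F : Chain N × Chain N} (hP : F ∈ FaiscP N) (hR : Reflexion F)
    {t₁ t₂ : ℝ} (h₁ : t₁ ∈ Set.Icc (0 : ℝ) 1) (h₂ : t₂ ∈ Set.Icc (0 : ℝ) 1) (h : t₁ < t₂)
    (i : Fin (N + 1)) : totalRatio (subBeam F t₁ t₂) i =
      ((1 - t₂) + t₂ * totalRatio F i) / ((1 - t₁) + t₁ * totalRatio F i) := by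
  induction i using Fin.induction with
  | zero => simp [totalRatio_zero]
  | succ i ih =>
    have hK := totalRatio_pos hP hR i.castSucc
    have hd₁ := (mob_den_pos hK h₁).ne'
    have hd₂ := (mob_den_pos hK h₂).ne'
    rw [totalRatio_succ, ih, stepRatio_subBeam hP hR h₁ h₂ h, totalRatio_succ,
      mob_den_mul hK h₁, mob_den_mul hK h₂, div_mul_div_comm, ← mul_div_assoc, ← mul_div_assoc,
      mul_div_cancel_left₀ _ hd₂, mul_div_cancel_left₀ _ hd₁]

lemma lineMap_mem_Icc {t₁ t₂ t : ℝ} (h₁ : t₁ ∈ Set.Icc (0 : ℝ) 1) (h₂ : t₂ ∈ Set.Icc (0 : ℝ) 1)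
    (ht : t ∈ Set.Icc (0 : ℝ) 1) : AffineMap.lineMap t₁ t₂ t ∈ Set.Icc (0 : ℝ) 1 := by
  rw [AffineMap.lineMap_apply, vsub_eq_sub, vadd_eq_add, smul_eq_mul]
  obtain ⟨p0, p1⟩ := h₁
  obtain ⟨q0, q1⟩ := h₂
  obtain ⟨r0, r1⟩ := ht
  constructor <;> nlinarith

/-- The rays of a part of a beam are rays of the beam. -/
lemma tChain_subBeam {N : ℕ} {F : Chain N × Chain N} (hP : F ∈ FaiscP N) (hR : Reflexion F)
    {t₁ t₂ t : ℝ} (h₁ : t₁ ∈ Set.Icc (0 : ℝ) 1) (h₂ : t₂ ∈ Set.Icc (0 : ℝ) 1) (h : t₁ < t₂)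
    (hs : t₁ + t₂ = 1) (ht : t ∈ Set.Icc (0 : ℝ) 1) :
    tChain (subBeam F t₁ t₂) t = tChain F (AffineMap.lineMap t₁ t₂ t) := by
  have hP' := subBeam_mem_FaiscP hP hR h₁ h₂ h hs
  have hR' := subBeam_reflexion hP hR h₁ h₂ h
  have h3 := lineMap_mem_Icc h₁ h₂ ht
  have key : ∀ i, impacts (subBeam F t₁ t₂) t i = impacts F (AffineMap.lineMap t₁ t₂ t) i := by
    intro i
    have hK := totalRatio_pos hP hR i
    -- Both sides become points of the original mirror, and `lineMap_mob` identifies their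
    -- parameters.
    rw [impacts_eq hP' hR' ht, impacts_eq hP hR h3, ← lineMap_mob hK h₁ h₂ ht,
      totalRatio_subBeam hP hR h₁ h₂ h]
    change AffineMap.lineMap (impacts F t₁ i) (impacts F t₂ i) _ = _
    rw [impacts_eq hP hR h₁, impacts_eq hP hR h₂]
    simp only [AffineMap.lineMap_apply, vsub_eq_sub, vadd_eq_add, smul_eq_mul]
    module
  funext k
  refine Fin.cases ?_ key k
  have e := key 0
  rw [impacts_zero, impacts_zero] at e
  change (AffineMap.lineMap ((subBeam F t₁ t₂).1 1) ((subBeam F t₁ t₂).2 1) t : Plane) +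
    (subBeam F t₁ t₂).1 0 = (AffineMap.lineMap (F.1 1) (F.2 1) (AffineMap.lineMap t₁ t₂ t)) + F.1 0
  rw [e, hP.2.1]
  rfl

/-- A centered part of a beam is a beam. -/
lemma subBeam_mem_Faisc {N : ℕ} {F : Chain N × Chain N} (hF : F ∈ Faisc N) {t₁ t₂ : ℝ}
    (h₁ : t₁ ∈ Set.Icc (0 : ℝ) 1) (h₂ : t₂ ∈ Set.Icc (0 : ℝ) 1) (h : t₁ < t₂)
    (hs : t₁ + t₂ = 1) : subBeam F t₁ t₂ ∈ Faisc N := by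
  obtain ⟨hP, hO, hR⟩ := hF
  refine ⟨subBeam_mem_FaiscP hP hR h₁ h₂ h hs, ?_, subBeam_reflexion hP hR h₁ h₂ h⟩
  intro j t ht k k0 k1 k2
  rw [tChain_subBeam hP hR h₁ h₂ h hs ht]
  refine Set.subset_eq_empty (Set.inter_subset_inter_right _ ?_)
    (hO j _ (lineMap_mem_Icc h₁ h₂ ht) k k0 k1 k2)
  exact (convex_segment _ _).segment_subset (subBeam_mem hP hR h₁ h₂ k).1
    (subBeam_mem hP hR h₁ h₂ k).2

lemma subBeam_zero_one {N : ℕ} {F : Chain N × Chain N} (hP : F ∈ FaiscP N) (hR : Reflexion F) :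
    subBeam F 0 1 = F := by
  have h0 : (0 : ℝ) ∈ Set.Icc (0 : ℝ) 1 := ⟨le_rfl, zero_le_one⟩
  have h1 : (1 : ℝ) ∈ Set.Icc (0 : ℝ) 1 := ⟨zero_le_one, le_rfl⟩
  refine Prod.ext (funext fun k => ?_) (funext fun k => ?_)
  · refine Fin.cases hP.2.1.symm (fun i => ?_) k
    change impacts F 0 i = _
    rw [impacts_eq hP hR h0, mob_zero, AffineMap.lineMap_apply_zero]
  · refine Fin.cases hP.2.2.1.symm (fun i => ?_) k
    change impacts F 1 i = _
    rw [impacts_eq hP hR h1, mob_one (totalRatio_pos hP hR i), AffineMap.lineMap_apply_one]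

/-! ### Continuity of the centered chain and narrowing of a beam. -/

lemma continuous_cross {X : Type*} [TopologicalSpace X] {f g : X → Plane} (hf : Continuous f)
    (hg : Continuous g) : Continuous fun x => cross (f x) (g x) := by
  unfold cross
  fun_prop

lemma continuous_stepRatio {N : ℕ} (i : Fin N) :
    Continuous fun F : Faisc N => stepRatio F.1 i := by
  unfold stepRatio
  split_ifs with hi
  · unfold pencilRatio
    have h1 : ∀ k, Continuous fun F : Faisc N => F.1.1 k := fun k => by fun_prop
    have h2 : ∀ k, Continuous fun F : Faisc N => F.1.2 k := fun k => by fun_prop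
    refine Continuous.div ?_ ?_ fun F => ?_
    · exact (continuous_cross ((h2 _).sub (h1 _)) ((h1 _).sub (h1 _))).mul
        (continuous_cross ((h2 _).sub (h1 _)) ((h2 _).sub (h2 _)))
    · exact (continuous_cross ((h2 _).sub (h1 _)) ((h2 _).sub (h2 _))).mul
        (continuous_cross ((h2 _).sub (h1 _)) ((h1 _).sub (h1 _)))
    · obtain ⟨σ, τ, -, q2, q3, -⟩ := step_cross F.2.1 F.2.2.2 i hi
      exact mul_ne_zero (right_ne_zero_of_mul q2.ne') (right_ne_zero_of_mul q3.ne')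
  · exact continuous_const

lemma continuous_totalRatio {N : ℕ} (i : Fin (N + 1)) :
    Continuous fun F : Faisc N => totalRatio F.1 i := by
  induction i using Fin.induction with
  | zero => exact continuous_const
  | succ i ih => exact ih.mul (continuous_stepRatio i)

lemma continuous_lineMap_plane {X : Type*} [TopologicalSpace X] {f g : X → Plane} {h : X → ℝ}
    (hf : Continuous f) (hg : Continuous g) (hh : Continuous h) :
    Continuous fun x => (AffineMap.lineMap (f x) (g x) (h x) : Plane) := by
  simp only [AffineMap.lineMap_apply, vsub_eq_sub, vadd_eq_add]
  exact (hh.smul (hg.sub hf)).add hf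

/-- By `impacts_eq`, the centered chain is a rational expression in the extreme chains, with
denominators that reflexion keeps positive. -/
lemma continuous_centered {N : ℕ} : Continuous (centered (N := N)) := by
  refine Continuous.subtype_mk (continuous_pi fun k => ?_) _
  have hi : ∀ i, Continuous fun F : Faisc N => impacts F.1 (1 / 2) i := by
    intro i
    have e : (fun F : Faisc N => impacts F.1 (1 / 2) i) = fun F : Faisc N =>
        AffineMap.lineMap (F.1.1 i.succ) (F.1.2 i.succ) (mob (totalRatio F.1 i) (1 / 2)) := by
      funext F
      exact impacts_eq F.2.1 F.2.2.2 half_mem i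
    rw [e]
    refine continuous_lineMap_plane (by fun_prop) (by fun_prop) ?_
    unfold mob
    refine Continuous.div ?_ ?_ fun F => (mob_den_pos (totalRatio_pos F.2.1 F.2.2.2 i) half_mem).ne'
    · exact continuous_const.mul (continuous_totalRatio i)
    · exact continuous_const.add (continuous_const.mul (continuous_totalRatio i))
  refine Fin.cases ?_ hi k
  exact (hi 0).add (by fun_prop)

lemma continuousOn_impacts {N : ℕ} {F : Chain N × Chain N} (hP : F ∈ FaiscP N) (hR : Reflexion F)
    (i : Fin (N + 1)) : ContinuousOn (fun t => impacts F t i) (Set.Icc 0 1) := by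
  have e : Set.EqOn (fun t => impacts F t i) (fun t =>
      AffineMap.lineMap (F.1 i.succ) (F.2 i.succ) (mob (totalRatio F i) t)) (Set.Icc 0 1) :=
    fun t ht => impacts_eq hP hR ht i
  refine ContinuousOn.congr ?_ e
  refine AffineMap.lineMap_continuous.comp_continuousOn ?_
  unfold mob
  refine ContinuousOn.div (by fun_prop) (by fun_prop) fun t ht =>
    (mob_den_pos (totalRatio_pos hP hR i) ht).ne'

lemma continuousOn_subBeam {N : ℕ} {F : Chain N × Chain N} (hP : F ∈ FaiscP N) (hR : Reflexion F) :
    ContinuousOn (fun t => subBeam F (1 / 2 - t) (1 / 2 + t)) (Set.Icc 0 (1 / 2)) := by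
  refine ContinuousOn.prodMk (continuousOn_pi.2 fun k => ?_) (continuousOn_pi.2 fun k => ?_)
  · refine Fin.cases continuousOn_const (fun i => ?_) k
    refine (continuousOn_impacts hP hR i).comp (f := fun t : ℝ => 1 / 2 - t) (by fun_prop) ?_
    rintro t ⟨h0, h1⟩
    constructor <;> linarith
  · refine Fin.cases continuousOn_const (fun i => ?_) k
    refine (continuousOn_impacts hP hR i).comp (f := fun t : ℝ => 1 / 2 + t) (by fun_prop) ?_
    rintro t ⟨h0, h1⟩
    constructor <;> linarith

/-- A beam can be narrowed around its centered chain. -/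
lemma joinedIn_subBeam {N : ℕ} {F : Chain N × Chain N} (hF : F ∈ Faisc N) {t : ℝ} (h0 : 0 < t)
    (h1 : t ≤ 1 / 2) : JoinedIn (Faisc N) F (subBeam F (1 / 2 - t) (1 / 2 + t)) := by
  have hsub : Set.Icc t (1 / 2) ⊆ Set.Icc 0 (1 / 2) := Set.Icc_subset_Icc_left h0.le
  have hpc : IsPathConnected (Set.Icc t (1 / 2)) :=
    (convex_Icc t (1 / 2)).isPathConnected ⟨t, le_rfl, h1⟩
  have him := hpc.image' ((continuousOn_subBeam hF.1 hF.2.2).mono hsub)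
  -- The half-width decreases from `1/2`, which gives the whole beam, to `t`; it stays positive,
  -- since width zero is not a beam.
  have h := him.joinedIn _ ⟨1 / 2, ⟨h1, le_rfl⟩, rfl⟩ _ ⟨t, ⟨le_rfl, h1⟩, rfl⟩
  have e : subBeam F (1 / 2 - 1 / 2) (1 / 2 + 1 / 2) = F := by
    norm_num [subBeam_zero_one hF.1 hF.2.2]
  simp only [e] at h
  refine h.mono ?_
  rintro _ ⟨s, ⟨hs0, hs1⟩, rfl⟩
  refine subBeam_mem_Faisc hF ⟨?_, ?_⟩ ⟨?_, ?_⟩ ?_ ?_ <;> linarith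

/-! ### The invariant is constant on connected components. -/

/-- The sign of the orientation of the mirror `j + 1`. -/
def orientation {N : ℕ} (F : Faisc N) (j : Fin N) : ℝ :=
  (-1) ^ ((j : ℕ) + 1) * cross (F.1.1 (midIdx j) - F.1.2 (midIdx j))
    ((centered F).1 (prevIdx j) - (centered F).1 (midIdx j))

lemma continuous_orientation {N : ℕ} (j : Fin N) :
    Continuous fun F : Faisc N => orientation F j := by
  unfold orientation
  have h : Continuous fun F : Faisc N => (centered F).1 :=
    continuous_subtype_val.comp continuous_centered
  refine continuous_const.mul (continuous_cross (by fun_prop) ?_)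
  exact ((continuous_apply _).comp h).sub ((continuous_apply _).comp h)

lemma mul_inner_normalOfAngle_angle_pos {x : Plane} (hx : x ≠ 0) (y : Plane) (e : ℝ) :
    0 < e * inner ℝ y (normalOfAngle (angle x)) ↔ 0 < e * cross x y := by
  obtain ⟨r, hr, e0, e1⟩ := norm_mul_cos_angle hx
  rw [inner_normalOfAngle]
  have : e * cross x y = r * (e * (y 1 * (angle x).cos - y 0 * (angle x).sin)) := by
    rw [cross, e0, e1]; ring
  rw [this, mul_pos_iff_of_pos_left hr]

/-- Membership of an angle in a half circle is the sign of a sine, hence of a cross product. This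
replaces angles by strict polynomial inequalities, on both sides of the mirror. -/
lemma carF_spec {N : ℕ} (F : Faisc N) (j : Fin N) :
    0 < ((carF F j : ℤ) : ℝ) * (-1) ^ ((j : ℕ) + 1) *
      cross (F.1.1 (midIdx j) - F.1.2 (midIdx j))
        ((centered F).1 (prevIdx j) - (centered F).1 (midIdx j)) ∧
    0 < ((carF F j : ℤ) : ℝ) * (-1) ^ ((j : ℕ) + 1) *
      cross (F.1.1 (midIdx j) - F.1.2 (midIdx j))
        ((centered F).1 (nextIdx j) - (centered F).1 (midIdx j)) := by
  have hx := sub_ne_zero.2 (F.2.1.1 j)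
  have hp := LR_mem_pos_iff (reflexiveChain F) j ((reflexiveChain F).1.2 j)
  have hn := LR_mem_neg_iff (reflexiveChain F) j ((reflexiveChain F).1.2 j)
  have hor := LR_pos_or_neg (reflexiveChain F) j
  change _ ↔ 0 < _ * inner ℝ _ (normalOfAngle (angle _)) ∧
    0 < _ * inner ℝ _ (normalOfAngle (angle _)) at hp
  change _ ↔ _ * inner ℝ _ (normalOfAngle (angle _)) < 0 ∧
    _ * inner ℝ _ (normalOfAngle (angle _)) < 0 at hn
  rw [← neg_pos, ← neg_pos (a := _ * inner ℝ ((reflexiveChain F).1.1 (nextIdx j) - _) _),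
    ← neg_mul, ← neg_mul] at hn
  rw [mul_inner_normalOfAngle_angle_pos hx, mul_inner_normalOfAngle_angle_pos hx] at hp hn
  have hc : (reflexiveChain F).1.1 = (centered F).1 := rfl
  rw [hc] at hp hn
  unfold carF car
  split_ifs with h
  · simpa using hp.1 h
  · simpa using hn.1 (hor.resolve_left h)

lemma carF_eq {N : ℕ} (F : Faisc N) (j : Fin N) :
    carF F j = if 0 < orientation F j then 1 else -1 := by
  have h := (carF_spec F j).1
  rw [mul_assoc] at h
  change 0 < _ * orientation F j at h
  rcases Int.units_eq_one_or (carF F j) with e | e <;> rw [e] at h ⊢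
  · rw [if_pos (by simpa using h)]
  · rw [if_neg (by simp at h; linarith)]

lemma orientation_ne_zero {N : ℕ} (F : Faisc N) (j : Fin N) : orientation F j ≠ 0 := by
  have h := (carF_spec F j).1
  rw [mul_assoc] at h
  exact right_ne_zero_of_mul h.ne'

/-- The characteristic is the sign of `orientation`, a continuous function without zeros, so it is
locally constant. -/
lemma continuous_carF {N : ℕ} : Continuous (carF (N := N)) := by
  refine continuous_pi fun j => continuous_iff_continuousAt.2 fun F => ?_
  have hc := (continuous_orientation j).continuousAt (x := F)
  rcases (orientation_ne_zero F j).lt_or_gt with h | h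
  · refine ContinuousAt.congr (f := fun _ => -1) continuousAt_const ?_
    filter_upwards [hc.eventually_lt continuousAt_const h] with G hG
    rw [carF_eq, if_neg hG.le.not_gt]
  · refine ContinuousAt.congr (f := fun _ => 1) continuousAt_const ?_
    filter_upwards [continuousAt_const.eventually_lt hc h] with G hG
    rw [carF_eq, if_pos hG]

lemma continuous_signF {N : ℕ} : Continuous (signF (N := N)) := by
  have h : Continuous fun c : Fin N → ℤˣ => fun k : Fin (N - 1) =>
      if c ⟨k, by omega⟩ = c ⟨k + 1, by omega⟩ then (1 : ℤˣ) else -1 :=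
    continuous_of_discreteTopology
  exact h.comp continuous_carF

/-- Since the target is totally disconnected, continuity alone makes the invariant constant on
connected components, and therefore along paths. -/
lemma continuous_invariantS {N : ℕ} : Continuous (invariantS (N := N)) := by
  refine Continuous.prodMk ?_ ?_
  · exact Continuous.quotient_lift (ConnectedComponents.continuous_coe.comp continuous_centered) _
  · exact Continuous.quotient_lift continuous_signF _

/-- Symmetrical beams in the same connected component have the same invariant. -/
lemma invariantS_eq_of_connectedComponent_eq {N : ℕ} {F F' : FaiscSym N}
    (h : connectedComponent F = connectedComponent F') : invariantS F = invariantS F' :=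
  continuous_invariantS.image_eq_of_connectedComponent_eq F F' h

/-! ### Openness of the space of chains. -/

lemma mem_segment_iff_dist (x p q : Plane) :
    x ∈ segment ℝ p q ↔ dist p x + dist x q = dist p q := by
  rw [dist_add_dist_eq_iff, mem_segment_iff_wbtw]

/-- This is the equality case of the Cauchy–Schwarz inequality. It turns membership in an unbounded,
moving half-line into an equation between continuous functions. -/
lemma mem_halfLine_iff {p q : Plane} (h : p ≠ q) (x : Plane) :
    x ∈ halfLine p q ↔ inner ℝ (x - q) (p - q) = ‖x - q‖ * ‖p - q‖ := by
  have h0 : 0 < ‖p - q‖ := norm_pos_iff.2 (sub_ne_zero.2 h)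
  rw [inner_eq_norm_mul_iff_real]
  constructor
  · rintro ⟨-, s, hs, rfl⟩
    rw [add_sub_cancel_left, norm_smul, Real.norm_of_nonneg hs, smul_smul, mul_comm]
  · intro e
    refine ⟨h, ‖x - q‖ / ‖p - q‖, by positivity, ?_⟩
    have : (‖x - q‖ / ‖p - q‖) • (p - q) = x - q := by
      rw [div_eq_inv_mul, ← smul_smul, ← e, smul_smul, inv_mul_cancel₀ h0.ne', one_smul]
    rw [this, add_sub_cancel]

lemma right_mem_ray {N : ℕ} {c : Chain N} (h : c 0 ≠ c 1) (j : Fin (N + 1)) :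
    c j.succ ∈ ray c j := by
  by_cases h0 : j = 0
  · subst h0
    rw [ray, if_pos rfl]
    exact ⟨h, 0, le_rfl, by simp⟩
  · rw [ray, if_neg h0]
    exact right_mem_segment ℝ _ _

lemma ray_nonempty {N : ℕ} {c : Chain N} (h : c 0 ≠ c 1) (j : Fin (N + 1)) : ray c j ≠ ∅ :=
  fun he => Set.eq_empty_iff_forall_notMem.1 he _ (right_mem_ray h j)

lemma LO_zero_ne_one {N : ℕ} {c : Chain N} (h : c ∈ LO N) : c 0 ≠ c 1 := by
  intro he
  refine h (Or.inl ⟨0, Or.inr ?_⟩)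
  rw [ray, if_pos rfl]
  exact Set.eq_empty_iff_forall_notMem.2 fun x hx => hx.1 he

/-- Two equal consecutive points past the source would put the second one at the end of the
preceding ray, which is an obscuration. -/
lemma LO_ne {N : ℕ} {c : Chain N} (h : c ∈ LO N) (j : Fin (N + 1)) :
    c j.castSucc ≠ c j.succ := by
  refine Fin.cases (LO_zero_ne_one h) (fun i he => ?_) j
  refine h (Or.inl ⟨i.castSucc, Or.inl ⟨i.succ.succ, Fin.succ_ne_zero _, ?_, ?_, ?_⟩⟩)
  · rw [Ne, Fin.ext_iff]
    simp
    omega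
  · rw [Ne, Fin.ext_iff]
    simp
  · rw [← he]
    exact right_mem_ray (LO_zero_ne_one h) i.castSucc

/-- All conditions become finitely many inequations between continuous functions. Grazing can be
stated with the closed segment because consecutive points are distinct. -/
lemma mem_LO_iff {N : ℕ} {c : Chain N} : c ∈ LO N ↔
    c 0 ≠ c 1 ∧
    (∀ k : Fin (N + 2), k ≠ 0 → k ≠ 1 →
      inner ℝ (c k - c 1) (c 0 - c 1) ≠ ‖c k - c 1‖ * ‖c 0 - c 1‖) ∧
    (∀ j : Fin N, ∀ k : Fin (N + 2), k ≠ 0 → k ≠ midIdx j → k ≠ nextIdx j →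
      dist (c (midIdx j)) (c k) + dist (c k) (c (nextIdx j)) ≠
        dist (c (midIdx j)) (c (nextIdx j))) ∧
    ∀ i : Fin N, dist (c (prevIdx i)) (c (midIdx i)) + dist (c (midIdx i)) (c (nextIdx i)) ≠
        dist (c (prevIdx i)) (c (nextIdx i)) := by
  constructor
  · intro h
    have h01 := LO_zero_ne_one h
    refine ⟨h01, ?_, ?_, ?_⟩
    · intro k k0 k1 he
      refine h (Or.inl ⟨0, Or.inl ⟨k, k0, k0, k1, ?_⟩⟩)
      rw [ray, if_pos rfl]
      exact (mem_halfLine_iff h01 _).2 he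
    · intro j k k0 k1 k2 he
      refine h (Or.inl ⟨j.succ, Or.inl ⟨k, k0, k1, k2, ?_⟩⟩)
      rw [ray, if_neg (Fin.succ_ne_zero _)]
      exact (mem_segment_iff_dist _ _ _).2 he
    · intro i he
      refine h (Or.inr ⟨i, ?_⟩)
      rw [← mem_segment_iff_dist] at he
      exact mem_openSegment_of_ne_left_right (LO_ne h i.castSucc) (LO_ne h i.succ).symm he
  · rintro ⟨h01, h1, h2, h3⟩ (⟨j, ⟨k, k0, k1, k2, hk⟩ | hj⟩ | ⟨i, hi⟩)
    · rcases Fin.eq_zero_or_eq_succ j with rfl | ⟨i, rfl⟩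
      · rw [ray, if_pos rfl, mem_halfLine_iff h01] at hk
        exact h1 k k0 k2 hk
      · rw [ray, if_neg (Fin.succ_ne_zero _), mem_segment_iff_dist] at hk
        exact h2 i k k0 k1 k2 hk
    · exact ray_nonempty h01 j hj
    · exact h3 i ((mem_segment_iff_dist _ _ _).1 (openSegment_subset_segment ℝ _ _ hi))

/-- Openness serves twice: components are path components, and a chain has a ball around it in which
mirrors may be opened without obscuration. -/
lemma isOpen_LO (N : ℕ) : IsOpen (LO N) := by
  have e : LO N = {c | c 0 ≠ c 1} ∩
    ((⋂ (k : Fin (N + 2)) (_ : k ≠ 0) (_ : k ≠ 1),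
      {c | inner ℝ (c k - c 1) (c 0 - c 1) ≠ ‖c k - c 1‖ * ‖c 0 - c 1‖}) ∩
    ((⋂ (j : Fin N) (k : Fin (N + 2)) (_ : k ≠ 0) (_ : k ≠ midIdx j) (_ : k ≠ nextIdx j),
      {c | dist (c (midIdx j)) (c k) + dist (c k) (c (nextIdx j)) ≠
        dist (c (midIdx j)) (c (nextIdx j))}) ∩
    ⋂ i : Fin N, {c | dist (c (prevIdx i)) (c (midIdx i)) +
      dist (c (midIdx i)) (c (nextIdx i)) ≠ dist (c (prevIdx i)) (c (nextIdx i))})) := by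
    ext c
    rw [mem_LO_iff]
    simp only [Set.mem_inter_iff, Set.mem_iInter, Set.mem_ofPred_eq]
  rw [e]
  refine (isOpen_ne_fun (by fun_prop) (by fun_prop)).inter
    (IsOpen.inter ?_ (IsOpen.inter ?_ ?_))
  · refine isOpen_iInter_of_finite fun k => isOpen_iInter_of_finite fun _ =>
      isOpen_iInter_of_finite fun _ => isOpen_ne_fun (by fun_prop) (by fun_prop)
  · refine isOpen_iInter_of_finite fun j => isOpen_iInter_of_finite fun k =>
      isOpen_iInter_of_finite fun _ => isOpen_iInter_of_finite fun _ =>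
      isOpen_iInter_of_finite fun _ => isOpen_ne_fun (by fun_prop) (by fun_prop)
  · exact isOpen_iInter_of_finite fun k => isOpen_ne_fun (by fun_prop) (by fun_prop)

/-! ### Normalization of chains by similarities. -/

/-- A map of the plane that preserves barycenters and is injective preserves the chains without
obscuration and grazing. -/
lemma LO_map {N : ℕ} {f : Plane → Plane} (hf : Function.Injective f)
    (hl : ∀ (p q : Plane) (s : ℝ), f (AffineMap.lineMap p q s) = AffineMap.lineMap (f p) (f q) s)
    {c : Chain N} (hc : c ∈ LO N) : (fun k => f (c k)) ∈ LO N := by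
  have himg : ∀ (p q x : Plane), f x ∈ segment ℝ (f p) (f q) → x ∈ segment ℝ p q := by
    intro p q x hx
    rw [segment_eq_image_lineMap] at hx ⊢
    obtain ⟨s, hs, e⟩ := hx
    rw [← hl] at e
    exact ⟨s, hs, hf e⟩
  have h01 := LO_zero_ne_one hc
  have h01' : f (c 0) ≠ f (c 1) := fun h => h01 (hf h)
  rintro (⟨j, ⟨k, k0, k1, k2, hk⟩ | hj⟩ | ⟨i, hi⟩)
  · refine hc (Or.inl ⟨j, Or.inl ⟨k, k0, k1, k2, ?_⟩⟩)
    by_cases h0 : j = 0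
    · rw [ray, if_pos h0] at hk ⊢
      obtain ⟨-, s, hs, e⟩ := hk
      refine ⟨h01, s, hs, hf ?_⟩
      have := hl (c 1) (c 0) s
      simp only [AffineMap.lineMap_apply, vsub_eq_sub, vadd_eq_add, add_comm (s • _)] at this
      rw [this]
      exact e
    · rw [ray, if_neg h0] at hk ⊢
      exact himg _ _ _ hk
  · exact ray_nonempty (c := fun k => f (c k)) h01' j hj
  · have h := himg _ _ _ (openSegment_subset_segment ℝ _ _ hi)
    exact hc (Or.inr ⟨i, mem_openSegment_of_ne_left_right (LO_ne hc i.castSucc)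
      (LO_ne hc i.succ).symm h⟩)

/-- The direct similarity that sends `p` to `(-1, 0)` and `q` to `0`. -/
def normalize (p q x : Plane) : Plane :=
  !₂[-((x 0 - q 0) * (p 0 - q 0) + (x 1 - q 1) * (p 1 - q 1)) /
      ((p 0 - q 0) ^ 2 + (p 1 - q 1) ^ 2),
    -((x 1 - q 1) * (p 0 - q 0) - (x 0 - q 0) * (p 1 - q 1)) /
      ((p 0 - q 0) ^ 2 + (p 1 - q 1) ^ 2)]

lemma sq_add_sq_pos {p q : Plane} (h : p ≠ q) : 0 < (p 0 - q 0) ^ 2 + (p 1 - q 1) ^ 2 := by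
  by_contra hc
  apply h
  have h0 : p 0 - q 0 = 0 := by nlinarith [sq_nonneg (p 0 - q 0), sq_nonneg (p 1 - q 1)]
  have h1 : p 1 - q 1 = 0 := by nlinarith [sq_nonneg (p 0 - q 0), sq_nonneg (p 1 - q 1)]
  ext i
  fin_cases i
  · exact sub_eq_zero.1 h0
  · exact sub_eq_zero.1 h1

lemma normalize_left {p q : Plane} (h : p ≠ q) : normalize p q p = !₂[-1, 0] := by
  have h0 := (sq_add_sq_pos h).ne'
  ext i
  fin_cases i
  · simp only [normalize, Fin.zero_eta, Matrix.cons_val_zero]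
    rw [div_eq_iff h0]
    ring
  · simp only [normalize, Fin.mk_one, Matrix.cons_val_one, Matrix.cons_val_zero]
    rw [div_eq_iff h0]
    ring

lemma normalize_right (p q : Plane) : normalize p q q = 0 := by
  ext i
  fin_cases i <;> simp [normalize]

lemma normalize_self (x : Plane) : normalize !₂[-1, 0] 0 x = x := by
  ext i
  fin_cases i <;> simp [normalize]

/-- In complex notation `normalize p q x` is `-(x - q) / (p - q)`, an affine map of `x`. -/
lemma normalize_lineMap (p q x y : Plane) (s : ℝ) :
    normalize p q (AffineMap.lineMap x y s) =
      AffineMap.lineMap (normalize p q x) (normalize p q y) s := by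
  ext i
  fin_cases i <;>
  · simp [normalize, AffineMap.lineMap_apply]
    ring

lemma normalize_injective {p q : Plane} (h : p ≠ q) : Function.Injective (normalize p q) := by
  intro x y e
  have h0 := sq_add_sq_pos h
  have e0 := congrArg (fun x : Plane => x 0) e
  have e1 := congrArg (fun x : Plane => x 1) e
  simp only [normalize, Matrix.cons_val_zero, Matrix.cons_val_one] at e0 e1
  rw [div_left_inj' h0.ne'] at e0 e1
  ext i
  fin_cases i
  · apply mul_right_cancel₀ h0.ne'
    simp only [Fin.zero_eta]
    linear_combination -(p 0 - q 0) * e0 + (p 1 - q 1) * e1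
  · apply mul_right_cancel₀ h0.ne'
    simp only [Fin.mk_one]
    linear_combination -(p 1 - q 1) * e0 - (p 0 - q 0) * e1

/-- The normalized chain. -/
def normChain {N : ℕ} (c : Chain N) : Chain N := fun k => normalize (c 0) (c 1) (c k)

lemma normChain_mem_LO {N : ℕ} {c : Chain N} (hc : c ∈ LO N) : normChain c ∈ LO N :=
  LO_map (normalize_injective (LO_zero_ne_one hc)) (normalize_lineMap _ _) hc

lemma normChain_eq_self {N : ℕ} {c : Chain N} (h0 : c 0 = !₂[-1, 0]) (h1 : c 1 = 0) :
    normChain c = c := by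
  funext k
  rw [normChain, h0, h1, normalize_self]

lemma continuousOn_normChain {N : ℕ} : ContinuousOn (normChain (N := N)) (LO N) := by
  refine continuousOn_pi.2 fun k => ?_
  have h0 : ∀ c ∈ LO N, (c 0 0 - c 1 0) ^ 2 + (c 0 1 - c 1 1) ^ 2 ≠ 0 :=
    fun c hc => (sq_add_sq_pos (LO_zero_ne_one hc)).ne'
  unfold normChain normalize
  refine (PiLp.continuous_toLp 2 _).comp_continuousOn (continuousOn_pi.2 fun i => ?_)
  fin_cases i
  · simp only [Fin.zero_eta, Matrix.cons_val_zero]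
    exact ContinuousOn.div (by fun_prop) (by fun_prop) h0
  · simp only [Fin.mk_one, Matrix.cons_val_one]
    exact ContinuousOn.div (by fun_prop) (by fun_prop) h0

/-- Two chains in the same connected component of `LO N` are joined by a path. -/
lemma joinedIn_LO {N : ℕ} {c c' : LO N} (h : nomenclature c = nomenclature c') :
    JoinedIn (LO N) c.1 c'.1 := by
  have := (isOpen_LO N).locallyPathConnectedSpace
  have h' := ConnectedComponents.coe_eq_coe'.1 h
  rw [← pathComponent_eq_connectedComponent] at h'
  have hj : Joined c c' := Joined.symm h'
  exact (joinedIn_iff_joined c.2 c'.2).2 hj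

/-- The set of the normalized chains without obscuration and grazing. -/
def LONorm (N : ℕ) : Set (Chain N) := {c | c ∈ LO N ∧ c 0 = !₂[-1, 0] ∧ c 1 = 0}

/-- Normalization is a retraction of `LO N` onto `LONorm N`, and a retraction carries a path between
two of its fixed points to a path in its image. -/
lemma joinedIn_LONorm {N : ℕ} {c c' : Chain N} (hc : c ∈ LONorm N) (hc' : c' ∈ LONorm N)
    (h : JoinedIn (LO N) c c') : JoinedIn (LONorm N) c c' := by
  have h' := h.map_continuousOn continuousOn_normChain
  rw [normChain_eq_self hc.2.1 hc.2.2, normChain_eq_self hc'.2.1 hc'.2.2] at h'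
  refine h'.mono ?_
  rintro _ ⟨x, hx, rfl⟩
  exact ⟨normChain_mem_LO hx, normalize_left (LO_zero_ne_one hx), normalize_right _ _⟩

/-! ### Thin beams around a chain. -/

/-- A thin beam is not obscured. -/
lemma mem_Faisc_of_ball {N : ℕ} {F : Chain N × Chain N} {c : Chain N} {δ : ℝ}
    (hP : F ∈ FaiscP N) (hR : Reflexion F) (hδ : Metric.ball c δ ⊆ LO N)
    (h0 : c 0 = !₂[-1, 0]) (h1 : c 1 = 0) (hF₁ : F.1 ∈ Metric.ball c δ)
    (hF₂ : F.2 ∈ Metric.ball c δ) : F ∈ Faisc N := by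
  have hpos : 0 < δ := Metric.pos_of_mem_ball hF₁
  have hcoord : ∀ {d : Chain N}, d ∈ Metric.ball c δ → ∀ k, d k ∈ Metric.ball (c k) δ :=
    fun hd k => (dist_pi_lt_iff hpos).1 hd k
  have hseg : ∀ k, segment ℝ (F.1 k) (F.2 k) ⊆ Metric.ball (c k) δ := fun k =>
    (convex_ball (c k) δ).segment_subset (hcoord hF₁ k) (hcoord hF₂ k)
  refine ⟨hP, ?_, hR⟩
  intro j t ht k k0 k1 k2
  rw [Set.eq_empty_iff_forall_notMem]
  rintro q ⟨hq, hqk⟩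
  -- For the source, `P₀ - c₀ = P₁ - c₁`, because both chains have the same offset `(-1, 0)` between
  -- their first two points.
  have hT : ∀ m, tChain F t m ∈ Metric.ball (c m) δ := by
    intro m
    by_cases hm : m = 0
    · subst hm
      have h := hseg 1 (tChain_mem hP hR ht (k := 1) (by simp))
      rw [Metric.mem_ball, h1, dist_zero_right] at h
      have e : tChain F t 0 = tChain F t 1 + F.1 0 := rfl
      rw [Metric.mem_ball, e, h0, hP.2.1, dist_eq_norm, add_sub_cancel_right]
      exact h
    · exact hseg m (tChain_mem hP hR ht hm)
  -- If a point `q` of the mirror `k` met the ray `j`, moving the `k`-th point of the `t`-chain to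
  -- `q` would give a chain still in the ball. The ray `j` is unchanged, as `k` is neither `j` nor
  -- `j + 1`, so this chain would be obscured, against `hδ`.
  have hp : Function.update (tChain F t) k q ∈ Metric.ball c δ := by
    rw [Metric.mem_ball, dist_pi_lt_iff hpos]
    intro m
    by_cases hm : m = k
    · subst hm
      rw [Function.update_self]
      exact hseg m hqk
    · rw [Function.update_of_ne hm]
      exact hT m
  have hray : ray (Function.update (tChain F t) k q) j = ray (tChain F t) j := by
    unfold ray
    split_ifs with hj
    · subst hj
      have k2' : (1 : Fin (N + 2)) ≠ k := k2.symm
      rw [Function.update_of_ne k0.symm, Function.update_of_ne k2']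
    · rw [Function.update_of_ne k1.symm, Function.update_of_ne k2.symm]
  refine hδ hp (Or.inl ⟨j, Or.inl ⟨k, k0, k1, k2, ?_⟩⟩)
  rw [hray, Function.update_self]
  exact hq

/-- Normalized chains with mirror directions, the mirrors having given orientations. -/
def Directed {N : ℕ} (e : Fin N → ℝ) : Set (Chain N × Chain N) :=
  {x | x.1 ∈ LONorm N ∧ x.2 0 = 0 ∧ x.2 (Fin.last (N + 1)) = 0 ∧ ∀ j : Fin N,
    0 < e j * cross (x.2 (midIdx j)) (x.1 (prevIdx j) - x.1 (midIdx j)) ∧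
    0 < e j * cross (x.2 (midIdx j)) (x.1 (nextIdx j) - x.1 (midIdx j))}

/-- The mirrors centered at the points of a chain, with given directions and size. -/
def thinBeam {N : ℕ} (x : Chain N × Chain N) (s : ℝ) : Chain N × Chain N :=
  (x.1 - s • x.2, x.1 + s • x.2)

lemma continuous_thinBeam {N : ℕ} :
    Continuous fun z : ℝ × (Chain N × Chain N) => thinBeam z.2 z.1 := by
  unfold thinBeam
  fun_prop

lemma thinBeam_zero {N : ℕ} (x : Chain N × Chain N) : thinBeam x 0 = (x.1, x.1) := by
  simp [thinBeam]

lemma Directed.ne_zero {N : ℕ} {e : Fin N → ℝ} {x : Chain N × Chain N} (hx : x ∈ Directed e)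
    (j : Fin N) : x.2 (midIdx j) ≠ 0 := by
  intro h
  have := (hx.2.2.2 j).1
  simp [h, cross] at this

lemma thinBeam_mem_FaiscP {N : ℕ} {e : Fin N → ℝ} {x : Chain N × Chain N} (hx : x ∈ Directed e)
    {s : ℝ} (hs : s ≠ 0) : thinBeam x s ∈ FaiscP N := by
  obtain ⟨⟨-, h0, h1⟩, d0, d1, -⟩ := id hx
  refine ⟨fun k h => ?_, ?_, ?_, ?_, ?_⟩
  · simp only [thinBeam, Pi.sub_apply, Pi.add_apply, Pi.smul_apply] at h
    have h2 : (2 * s) • x.2 (midIdx k) = 0 := by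
      rw [two_mul, add_smul]
      have := sub_eq_zero.2 h.symm
      rw [← this]
      abel
    exact smul_ne_zero (mul_ne_zero two_ne_zero hs) (Directed.ne_zero hx k) h2
  · simp [thinBeam, h0, d0]
  · simp [thinBeam, h0, d0]
  · simp [thinBeam, d1]
  · simp [thinBeam, h1]

/-- Near a chain with directions, small mirrors define beams. -/
lemma eventually_thinBeam_mem {N : ℕ} {e : Fin N → ℝ} {x : Chain N × Chain N}
    (hx : x ∈ Directed e) : ∀ᶠ z : ℝ × (Chain N × Chain N) in 𝓝 (0, x),
      z.2 ∈ Directed e → 0 < z.1 → thinBeam z.2 z.1 ∈ Faisc N := by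
  -- At size `0` both extreme chains equal the base chain, for which the ball condition and the
  -- strict inequalities hold; being open, they persist near `(0, x)`.
  obtain ⟨δ, hδ, hball⟩ := Metric.isOpen_iff.1 (isOpen_LO N) x.1 hx.1.1
  have hB : ContinuousAt (fun z : ℝ × (Chain N × Chain N) => thinBeam z.2 z.1) (0, x) :=
    continuous_thinBeam.continuousAt
  have hB1 : ∀ᶠ z : ℝ × (Chain N × Chain N) in 𝓝 (0, x),
      (thinBeam z.2 z.1).1 ∈ Metric.ball x.1 δ := by
    refine (continuous_fst.continuousAt.comp hB).eventually_mem (Metric.isOpen_ball.mem_nhds ?_)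
    simpa [thinBeam_zero] using hδ
  have hB2 : ∀ᶠ z : ℝ × (Chain N × Chain N) in 𝓝 (0, x),
      (thinBeam z.2 z.1).2 ∈ Metric.ball x.1 δ := by
    refine (continuous_snd.continuousAt.comp hB).eventually_mem (Metric.isOpen_ball.mem_nhds ?_)
    simpa [thinBeam_zero] using hδ
  have c1 : Continuous fun z : ℝ × (Chain N × Chain N) => (thinBeam z.2 z.1).1 :=
    continuous_fst.comp continuous_thinBeam
  have c2 : Continuous fun z : ℝ × (Chain N × Chain N) => (thinBeam z.2 z.1).2 :=
    continuous_snd.comp continuous_thinBeam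
  have hcr : ∀ (f : ℝ × (Chain N × Chain N) → Chain N) (_ : Continuous f) (_ : f (0, x) = x.1)
      (j : Fin N), ∀ᶠ z : ℝ × (Chain N × Chain N) in 𝓝 (0, x),
      0 < e j * cross (z.2.2 (midIdx j)) (f z (prevIdx j) - f z (midIdx j)) ∧
      0 < e j * cross (z.2.2 (midIdx j)) (f z (nextIdx j) - f z (midIdx j)) := by
    intro f hf h0 j
    have hk : ∀ k, Continuous fun z => f z k := fun k => (continuous_apply k).comp hf
    have g : ∀ k, Continuous fun z : ℝ × (Chain N × Chain N) =>
        e j * cross (z.2.2 (midIdx j)) (f z k - f z (midIdx j)) := fun k =>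
      continuous_const.mul (continuous_cross (by fun_prop) ((hk k).sub (hk _)))
    refine ((g _).continuousAt.eventually_mem (isOpen_Ioi.mem_nhds ?_)).and
      ((g _).continuousAt.eventually_mem (isOpen_Ioi.mem_nhds ?_))
    · simp only [h0]; exact (hx.2.2.2 j).1
    · simp only [h0]; exact (hx.2.2.2 j).2
  have hC1 := eventually_all.2 (hcr _ c1 (by simp [thinBeam_zero]))
  have hC2 := eventually_all.2 (hcr _ c2 (by simp [thinBeam_zero]))
  filter_upwards [hB1, hB2, hC1, hC2] with z b1 b2 k1 k2 hz hs
  have hP := thinBeam_mem_FaiscP hz hs.ne'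
  refine mem_Faisc_of_ball hP (reflexion_of_cross hP.1 fun j => ⟨e j, ?_⟩) hball hx.1.2.1 hx.1.2.2
    b1 b2
  have hd : ∀ v, e j * cross ((thinBeam z.2 z.1).2 (midIdx j) - (thinBeam z.2 z.1).1 (midIdx j)) v
      = (2 * z.1) * (e j * cross (z.2.2 (midIdx j)) v) := by
    intro v
    simp only [thinBeam, cross, Pi.sub_apply, Pi.add_apply, Pi.smul_apply, PiLp.sub_apply,
      PiLp.add_apply, PiLp.smul_apply, smul_eq_mul]
    ring
  simp only [hd]
  have h2 : 0 < 2 * z.1 := by linarith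
  exact ⟨mul_pos h2 (k1 j).1, mul_pos h2 (k2 j).1, mul_pos h2 (k1 j).2, mul_pos h2 (k2 j).2⟩

/-- Paths of chains with directions lift to paths of thin beams. -/
lemma eventually_joinedIn_thinBeam {N : ℕ} {e : Fin N → ℝ} {x y : Chain N × Chain N}
    (h : JoinedIn (Directed e) x y) :
    ∀ᶠ s : ℝ in 𝓝 0, 0 < s → JoinedIn (Faisc N) (thinBeam x s) (thinBeam y s) := by
  obtain ⟨γ, hγ⟩ := h
  have hK : IsCompact (Set.range γ) := isCompact_range γ.continuous
  -- The admissible size depends on the point of the path; compactness of the path provides a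
  -- uniform one.
  have hev := hK.eventually_forall_of_forall_eventually (x₀ := (0 : ℝ))
    (P := fun s z => z ∈ Directed e → 0 < s → thinBeam z s ∈ Faisc N) (by
      rintro _ ⟨t, rfl⟩
      exact eventually_thinBeam_mem (hγ t))
  filter_upwards [hev] with s hs hs0
  have hc : Continuous fun z : Chain N × Chain N => thinBeam z s :=
    continuous_thinBeam.comp (Continuous.prodMk_right s)
  refine ⟨(γ.map hc).cast (by simp) (by simp), fun t => ?_⟩
  exact hs _ ⟨t, rfl⟩ (hγ t) hs0

/-! ### Exterior bisectors and lifting of paths of chains. -/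

/-- The direction of the exterior bisector of two vectors. -/
def bisector (u v : Plane) : Plane :=
  !₂[‖v‖ * u 1 + ‖u‖ * v 1, -(‖v‖ * u 0 + ‖u‖ * v 0)]

/-- The vector is a quarter turn of `‖v‖ u + ‖u‖ v`. For nonzero `u` and `v` the value is positive
unless they are opposite, which is exactly the grazing case. -/
lemma cross_bisector_left (u v : Plane) :
    cross (bisector u v) u = ‖u‖ * (‖u‖ * ‖v‖ + inner ℝ u v) := by
  have h : ‖u‖ ^ 2 = u 0 ^ 2 + u 1 ^ 2 := by rw [EuclideanSpace.real_norm_sq_eq, Fin.sum_univ_two]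
  simp only [cross, bisector, inner_plane, Matrix.cons_val_zero, Matrix.cons_val_one]
  linear_combination -‖v‖ * h

lemma cross_bisector_right (u v : Plane) :
    cross (bisector u v) v = ‖v‖ * (‖u‖ * ‖v‖ + inner ℝ u v) := by
  have h : ‖v‖ ^ 2 = v 0 ^ 2 + v 1 ^ 2 := by rw [EuclideanSpace.real_norm_sq_eq, Fin.sum_univ_two]
  simp only [cross, bisector, inner_plane, Matrix.cons_val_zero, Matrix.cons_val_one]
  linear_combination -‖u‖ * h

lemma LO_bisector {N : ℕ} {c : Chain N} (hc : c ∈ LO N) (j : Fin N) :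
    0 < cross (bisector (c (prevIdx j) - c (midIdx j)) (c (nextIdx j) - c (midIdx j)))
      (c (prevIdx j) - c (midIdx j)) ∧
    0 < cross (bisector (c (prevIdx j) - c (midIdx j)) (c (nextIdx j) - c (midIdx j)))
      (c (nextIdx j) - c (midIdx j)) := by
  have hu : 0 < ‖c (prevIdx j) - c (midIdx j)‖ :=
    norm_pos_iff.2 (sub_ne_zero.2 (LO_ne hc j.castSucc))
  have hv : 0 < ‖c (nextIdx j) - c (midIdx j)‖ :=
    norm_pos_iff.2 (sub_ne_zero.2 (LO_ne hc j.succ).symm)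
  have hg := (mem_LO_iff.1 hc).2.2.2 j
  rw [dist_eq_norm, dist_comm (c (midIdx j)), dist_eq_norm, dist_eq_norm,
    ← sub_sub_sub_cancel_right (c (prevIdx j)) (c (nextIdx j)) (c (midIdx j))] at hg
  rw [cross_bisector_left, cross_bisector_right]
  generalize c (prevIdx j) - c (midIdx j) = u at *
  generalize c (nextIdx j) - c (midIdx j) = v at *
  -- Equality would give `‖u - v‖ = ‖u‖ + ‖v‖`, which puts the mirror point on the segment between
  -- its neighbours.
  have h : 0 < ‖u‖ * ‖v‖ + inner ℝ u v := by
    have h1 := abs_le.1 (abs_real_inner_le_norm u v)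
    refine lt_of_le_of_ne (by linarith [h1.1]) fun he => hg ?_
    have h2 := norm_sub_sq_real u v
    rw [← pow_left_inj₀ (by positivity) (by positivity) two_ne_zero, h2]
    linear_combination -2 * he
  exact ⟨mul_pos hu h, mul_pos hv h⟩

/-- The bisecting directions along a chain. -/
def bisectors {N : ℕ} (e : Fin N → ℝ) (c : Chain N) : Chain N :=
  Fin.cons (α := fun _ => Plane) 0 (Fin.snoc (α := fun _ => Plane) (fun j : Fin N =>
    e j • bisector (c (prevIdx j) - c (midIdx j)) (c (nextIdx j) - c (midIdx j))) 0)

lemma bisectors_midIdx {N : ℕ} (e : Fin N → ℝ) (c : Chain N) (j : Fin N) :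
    bisectors e c (midIdx j) =
      e j • bisector (c (prevIdx j) - c (midIdx j)) (c (nextIdx j) - c (midIdx j)) := by
  rw [bisectors, midIdx, Fin.cons_succ, Fin.snoc_castSucc]
  rfl

lemma bisectors_last {N : ℕ} (e : Fin N → ℝ) (c : Chain N) :
    bisectors e c (Fin.last (N + 1)) = 0 := by
  rw [bisectors, ← Fin.succ_last, Fin.cons_succ, Fin.snoc_last]

/-- The factor `e j` in the direction meets the factor `e j` of the condition, and the square is
positive whatever the sign. -/
lemma bisectors_mem {N : ℕ} {e : Fin N → ℝ} (he : ∀ j, e j ≠ 0) {c : Chain N}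
    (hc : c ∈ LONorm N) : (c, bisectors e c) ∈ Directed e := by
  refine ⟨hc, rfl, bisectors_last e c, fun j => ?_⟩
  have hs : ∀ u v : Plane, e j * cross (e j • u) v = e j ^ 2 * cross u v := by
    intro u v
    simp only [cross, PiLp.smul_apply, smul_eq_mul]
    ring
  have h2 : 0 < e j ^ 2 := by have := he j; positivity
  simp only [bisectors_midIdx, hs]
  exact ⟨mul_pos h2 (LO_bisector hc.1 j).1, mul_pos h2 (LO_bisector hc.1 j).2⟩

lemma continuous_bisectors {N : ℕ} (e : Fin N → ℝ) : Continuous (bisectors e) := by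
  refine continuous_pi fun k => ?_
  rcases Fin.eq_zero_or_eq_succ k with rfl | ⟨i, rfl⟩
  · exact continuous_const
  · rcases Fin.eq_castSucc_or_eq_last i with ⟨j, rfl⟩ | rfl
    · change Continuous fun c => bisectors e c (midIdx j)
      simp only [bisectors_midIdx]
      have hb : Continuous fun c : Chain N =>
          bisector (c (prevIdx j) - c (midIdx j)) (c (nextIdx j) - c (midIdx j)) := by
        unfold bisector
        refine (PiLp.continuous_toLp 2 (fun _ : Fin 2 => ℝ)).comp (continuous_pi fun i => ?_)
        fin_cases i
        · simp only [Fin.zero_eta, Matrix.cons_val_zero]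
          fun_prop
        · simp only [Fin.mk_one, Matrix.cons_val_one]
          fun_prop
      exact hb.const_smul (e j)
    · simp only [Fin.succ_last, bisectors_last]
      exact continuous_const

/-- Over a fixed chain the conditions on the directions are linear strict inequalities, so a
straight segment joins any two admissible choices. -/
lemma joinedIn_bisectors {N : ℕ} {e : Fin N → ℝ} {c d : Chain N} (he : ∀ j, e j ≠ 0)
    (h : (c, d) ∈ Directed e) : JoinedIn (Directed e) (c, d) (c, bisectors e c) := by
  refine JoinedIn.of_segment_subset ?_
  obtain ⟨-, b0, b1, b2⟩ := bisectors_mem he h.1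
  obtain ⟨hc, d0, d1, d2⟩ := h
  dsimp only at b0 b1 b2 hc d0 d1 d2
  rintro _ ⟨p, q, hp, hq, hpq, rfl⟩
  have e1 : p • c + q • c = c := by rw [← add_smul, hpq, one_smul]
  refine ⟨?_, ?_, ?_, fun j => ?_⟩
  · simpa only [Prod.fst_add, Prod.smul_mk, e1] using hc
  · simp only [Prod.snd_add, Prod.smul_mk, Pi.add_apply, Pi.smul_apply]
    rw [d0, b0, smul_zero, smul_zero, add_zero]
  · simp only [Prod.snd_add, Prod.smul_mk, Pi.add_apply, Pi.smul_apply]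
    rw [d1, b1, smul_zero, smul_zero, add_zero]
  · have hx : ∀ u v w : Plane, e j * cross (p • u + q • v) w =
        p * (e j * cross u w) + q * (e j * cross v w) := by
      intro u v w
      simp only [cross, PiLp.add_apply, PiLp.smul_apply, smul_eq_mul]
      ring
    have hpos : ∀ s t : ℝ, 0 < s → 0 < t → 0 < p * s + q * t := by
      intro s t hs ht
      rcases hp.eq_or_lt with rfl | hp'
      · have : q = 1 := by linarith
        subst this
        simpa using ht
      · have := mul_pos hp' hs
        have := mul_nonneg hq ht.le
        linarith
    simp only [Prod.fst_add, Prod.snd_add, Prod.smul_mk, e1]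
    simp only [Pi.add_apply, Pi.smul_apply, hx]
    exact ⟨hpos _ _ (d2 j).1 (b2 j).1, hpos _ _ (d2 j).2 (b2 j).2⟩

/-- The fibers over normalized chains are convex and `bisectors e` is a continuous section: go to
the section, follow the path of chains along it, and return within the last fiber. -/
lemma joinedIn_Directed {N : ℕ} {e : Fin N → ℝ} (he : ∀ j, e j ≠ 0) {x y : Chain N × Chain N}
    (hx : x ∈ Directed e) (hy : y ∈ Directed e) (h : JoinedIn (LO N) x.1 y.1) :
    JoinedIn (Directed e) x y := by
  refine (joinedIn_bisectors he hx).trans (JoinedIn.trans ?_ (joinedIn_bisectors he hy).symm)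
  have hm := (joinedIn_LONorm hx.1 hy.1 h).map (f := fun c => (c, bisectors e c))
    (continuous_id.prodMk (continuous_bisectors e))
  refine hm.mono ?_
  rintro _ ⟨c, hc, rfl⟩
  exact bisectors_mem he hc

/-! ### Contraction of a beam to a thin beam. -/

/-- The mirrors of a beam shrunk around a chain. -/
def Shrunk {N : ℕ} (F : Chain N × Chain N) (U : Set (Chain N)) : Set (Chain N × Chain N) :=
  {G | (∀ k, G.1 k ∈ segment ℝ (F.1 k) (F.2 k)) ∧ (∀ k, G.2 k ∈ segment ℝ (F.1 k) (F.2 k)) ∧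
    (∀ i : Fin N, ∃ r : ℝ, 0 < r ∧
      G.2 (midIdx i) - G.1 (midIdx i) = r • (F.2 (midIdx i) - F.1 (midIdx i))) ∧
    G.1 1 + G.2 1 = 0 ∧ G.1 ∈ U ∧ G.2 ∈ U}

/-- Every clause is convex in the pair of chains; in particular the positive factors `r` interpolate
linearly. Straight segments can thus be used here, whereas non-obscuration gives no direct control
along them. -/
lemma convex_Shrunk {N : ℕ} (F : Chain N × Chain N) {U : Set (Chain N)} (hU : Convex ℝ U) :
    Convex ℝ (Shrunk F U) := by
  rintro G ⟨g1, g2, g3, g4, g5, g6⟩ H ⟨h1, h2, h3, h4, h5, h6⟩ p q hp hq hpq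
  refine ⟨fun k => convex_segment _ _ (g1 k) (h1 k) hp hq hpq,
    fun k => convex_segment _ _ (g2 k) (h2 k) hp hq hpq, fun i => ?_, ?_,
    hU g5 h5 hp hq hpq, hU g6 h6 hp hq hpq⟩
  · obtain ⟨r, hr, e⟩ := g3 i
    obtain ⟨s, hs, f⟩ := h3 i
    refine ⟨p * r + q * s, ?_, ?_⟩
    · rcases hp.eq_or_lt with rfl | hp'
      · have : q = 1 := by linarith
        subst this
        simpa using hs
      · have := mul_pos hp' hr
        have := mul_nonneg hq hs.le
        linarith
    · rw [add_smul, mul_smul, mul_smul, ← e, ← f]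
      simp only [Prod.fst_add, Prod.snd_add, Prod.smul_fst, Prod.smul_snd, Pi.add_apply,
        Pi.smul_apply]
      module
  · have : (p • G + q • H).1 1 + (p • G + q • H).2 1 =
        p • (G.1 1 + G.2 1) + q • (H.1 1 + H.2 1) := by
      simp only [Prod.fst_add, Prod.snd_add, Prod.smul_fst, Prod.smul_snd, Pi.add_apply,
        Pi.smul_apply]
      module
    rw [this, g4, h4, smul_zero, smul_zero, add_zero]

lemma midpoint_eq_zero_iff_add (p q : Plane) : midpoint ℝ p q = 0 ↔ p + q = 0 := by
  rw [midpoint_eq_smul_add, smul_eq_zero]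
  simp

lemma Shrunk_subset {N : ℕ} {F : Chain N × Chain N} (hF : F ∈ Faisc N) {δ : ℝ}
    (hδ : Metric.ball (tChain F (1 / 2)) δ ⊆ LO N) :
    Shrunk F (Metric.ball (tChain F (1 / 2)) δ) ⊆ Faisc N := by
  obtain ⟨hP, -, hR⟩ := hF
  rintro G ⟨g1, g2, g3, g4, g5, g6⟩
  have hz := g1 0
  have hz' := g2 0
  rw [hP.2.1, hP.2.2.1, segment_same, Set.mem_singleton_iff] at hz hz'
  have hl := g1 (Fin.last (N + 1))
  have hl' := g2 (Fin.last (N + 1))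
  rw [hP.2.2.2.1, segment_same, Set.mem_singleton_iff] at hl hl'
  refine mem_Faisc_of_ball ⟨fun k hk => ?_, hz, hz', hl.trans hl'.symm,
    (midpoint_eq_zero_iff_add _ _).2 g4⟩ (reflexion_of_subset hP hR g1 g2 g3) hδ
    ((tChain_half_zero hP).trans hP.2.1) (tChain_half_one hP) g5 g6
  obtain ⟨r, hr, e⟩ := g3 k
  rw [hk, sub_self] at e
  exact smul_ne_zero hr.ne' (sub_ne_zero.2 (hP.1 k).symm) e.symm

/-- The centered chain of a beam with the directions of the mirrors. -/
def directions {N : ℕ} (F : Chain N × Chain N) : Chain N × Chain N :=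
  (tChain F (1 / 2), F.2 - F.1)

/-- The minus sign comes from the characteristic using `a - b` while the directions are `b - a`. -/
lemma directions_mem {N : ℕ} (F : Faisc N) :
    directions F.1 ∈ Directed fun j : Fin N => -(((carF F j : ℤ) : ℝ) * (-1) ^ ((j : ℕ) + 1)) := by
  have hP := F.2.1
  refine ⟨⟨(centered F).2, (tChain_half_zero hP).trans hP.2.1, tChain_half_one hP⟩, ?_, ?_,
    fun j => ?_⟩
  · change F.1.2 0 - F.1.1 0 = 0
    rw [hP.2.1, hP.2.2.1, sub_self]
  · change F.1.2 (Fin.last (N + 1)) - F.1.1 (Fin.last (N + 1)) = 0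
    rw [hP.2.2.2.1, sub_self]
  · have h := carF_spec F j
    have e : ∀ (s : ℝ) (v : Plane), -s * cross (F.1.2 (midIdx j) - F.1.1 (midIdx j)) v =
        s * cross (F.1.1 (midIdx j) - F.1.2 (midIdx j)) v := by
      intro s v
      simp only [cross, PiLp.sub_apply]
      ring
    change 0 < _ * cross (F.1.2 (midIdx j) - F.1.1 (midIdx j)) _ ∧
      0 < _ * cross (F.1.2 (midIdx j) - F.1.1 (midIdx j)) _
    rw [e, e]
    exact h

/-- The points of the centered chain are interior to the mirrors. -/
lemma eventually_lineMap_mem_segment {N : ℕ} {F : Chain N × Chain N} (hP : F ∈ FaiscP N)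
    (hR : Reflexion F) (k : Fin (N + 2)) :
    ∀ᶠ s : ℝ in 𝓝 0, tChain F (1 / 2) k + s • (F.2 k - F.1 k) ∈ segment ℝ (F.1 k) (F.2 k) := by
  rcases Fin.eq_zero_or_eq_succ k with rfl | ⟨i, rfl⟩
  · refine Eventually.of_forall fun s => ?_
    rw [tChain_half_zero hP, hP.2.1, hP.2.2.1, sub_self, smul_zero, add_zero]
    exact left_mem_segment ℝ _ _
  · have hK := totalRatio_pos hP hR i
    -- Strict monotonicity of `mob` places the parameter of the centered point strictly between `0`
    -- and `1`.
    have h0 := mob_lt hK ⟨le_rfl, zero_le_one⟩ half_mem (by norm_num : (0 : ℝ) < 1 / 2)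
    have h1 := mob_lt hK half_mem ⟨zero_le_one, le_rfl⟩ (by norm_num : (1 / 2 : ℝ) < 1)
    rw [mob_zero] at h0
    rw [mob_one hK] at h1
    have hc : ContinuousAt (fun s : ℝ => mob (totalRatio F i) (1 / 2) + s) 0 := by fun_prop
    filter_upwards [hc.eventually_mem (isOpen_Ioo.mem_nhds (s := Set.Ioo (0 : ℝ) 1)
      ⟨by simpa using h0, by simpa using h1⟩)] with s hs
    have e : tChain F (1 / 2) i.succ + s • (F.2 i.succ - F.1 i.succ) =
        AffineMap.lineMap (F.1 i.succ) (F.2 i.succ) (mob (totalRatio F i) (1 / 2) + s) := by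
      change impacts F (1 / 2) i + _ = _
      rw [impacts_eq hP hR half_mem]
      simp only [AffineMap.lineMap_apply, vsub_eq_sub, vadd_eq_add]
      module
    rw [e]
    exact lineMap_mem_segment (Set.Ioo_subset_Icc_self hs)

/-- A beam can be deformed to a thin beam. -/
lemma eventually_joinedIn_thinBeam_directions {N : ℕ} {F : Chain N × Chain N} (hF : F ∈ Faisc N) :
    ∀ᶠ s : ℝ in 𝓝 0, 0 < s → JoinedIn (Faisc N) F (thinBeam (directions F) s) := by
  obtain ⟨hP, -, hR⟩ := id hF
  obtain ⟨δ, hδ, hball⟩ := Metric.isOpen_iff.1 (isOpen_LO N) _ (centered_mem_LO hF)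
  have hnb : Metric.ball (tChain F (1 / 2)) δ ∈ 𝓝 (tChain F (1 / 2)) :=
    Metric.ball_mem_nhds _ hδ
  -- a narrow part of the beam
  obtain ⟨t, ht0, ht1, hts⟩ : ∃ t : ℝ, 0 < t ∧ t ≤ 1 / 2 ∧
      subBeam F (1 / 2 - t) (1 / 2 + t) ∈ Shrunk F (Metric.ball (tChain F (1 / 2)) δ) := by
    -- As the half-width tends to `0`, both extreme chains tend to the centered chain, so a small
    -- positive half-width brings them into the ball.
    have hc := (continuousOn_subBeam hP hR) 0 ⟨le_rfl, by norm_num⟩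
    have e0 : (Fin.cons (!₂[-1, 0] : Plane) (impacts F (1 / 2)) : Chain N) = tChain F (1 / 2) := by
      funext k
      refine Fin.cases ?_ (fun i => rfl) k
      exact ((tChain_half_zero hP).trans hP.2.1).symm
    have hc' : Tendsto (fun t : ℝ => subBeam F (1 / 2 - t) (1 / 2 + t))
        (𝓝[Set.Icc 0 (1 / 2)] 0) (𝓝 (tChain F (1 / 2), tChain F (1 / 2))) := by
      have := hc.tendsto
      simpa only [subBeam, sub_zero, add_zero, e0] using this
    have hev := hc'.eventually (prod_mem_nhds hnb hnb)
    have hev' : ∀ᶠ t in 𝓝[>] (0 : ℝ), subBeam F (1 / 2 - t) (1 / 2 + t) ∈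
        Metric.ball (tChain F (1 / 2)) δ ×ˢ Metric.ball (tChain F (1 / 2)) δ := by
      have hle : 𝓝[Set.Ioc 0 (1 / 2)] (0 : ℝ) ≤ 𝓝[Set.Icc 0 (1 / 2)] 0 :=
        nhdsWithin_mono _ Set.Ioc_subset_Icc_self
      rw [← nhdsWithin_Ioc_eq_nhdsGT (by norm_num : (0 : ℝ) < 1 / 2)]
      exact hev.filter_mono hle
    have hIoc : ∀ᶠ t in 𝓝[>] (0 : ℝ), t ∈ Set.Ioc (0 : ℝ) (1 / 2) :=
      Ioc_mem_nhdsGT (by norm_num)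
    obtain ⟨t, ⟨b1, b2⟩, t0, t1⟩ := (hev'.and hIoc).exists
    have h₁ : 1 / 2 - t ∈ Set.Icc (0 : ℝ) 1 := ⟨by linarith, by linarith⟩
    have h₂ : 1 / 2 + t ∈ Set.Icc (0 : ℝ) 1 := ⟨by linarith, by linarith⟩
    have hm := (subBeam_mem_FaiscP hP hR h₁ h₂ (by linarith) (by ring)).2.2.2.2
    exact ⟨t, t0, t1, fun k => (subBeam_mem hP hR h₁ h₂ k).1,
      fun k => (subBeam_mem hP hR h₁ h₂ k).2,
      fun i => ⟨_, sub_pos.2 (mob_lt (totalRatio_pos hP hR _) h₁ h₂ (by linarith)),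
        subBeam_sub hP hR h₁ h₂ i.castSucc⟩, (midpoint_eq_zero_iff_add _ _).1 hm, b1, b2⟩
  have hpos := eventually_all.2 fun k => eventually_lineMap_mem_segment hP hR k
  -- The other ends of the thin mirrors correspond to the parameter `-s`.
  have hneg := (continuous_neg.tendsto' (0 : ℝ) 0 neg_zero).eventually hpos
  have hB : ContinuousAt (fun s : ℝ => thinBeam (directions F) s) 0 :=
    (continuous_thinBeam.comp (Continuous.prodMk_left (directions F))).continuousAt
  have hthin : ∀ᶠ s : ℝ in 𝓝 0, thinBeam (directions F) s ∈
      Metric.ball (tChain F (1 / 2)) δ ×ˢ Metric.ball (tChain F (1 / 2)) δ := by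
    refine hB.eventually_mem ?_
    rw [thinBeam_zero]
    exact prod_mem_nhds hnb hnb
  filter_upwards [hpos, hneg, hthin] with s hs1 hs2 hs3 hs0
  -- The centered points need not be the midpoints of the narrowed mirrors, since the maps between
  -- mirrors are projective; a segment in the convex set `Shrunk` corrects this.
  refine (joinedIn_subBeam hF ht0 ht1).trans (JoinedIn.of_segment_subset ?_)
  refine Set.Subset.trans ((convex_Shrunk F (convex_ball _ δ)).segment_subset hts ?_)
    (Shrunk_subset hF hball)
  refine ⟨fun k => ?_, hs1, fun i => ⟨2 * s, by linarith, ?_⟩, ?_, hs3.1, hs3.2⟩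
  · have h := hs2 k
    rw [neg_smul, ← sub_eq_add_neg] at h
    exact h
  · simp only [thinBeam, directions, Pi.sub_apply, Pi.add_apply, Pi.smul_apply]
    module
  · have h1 := tChain_half_one hP
    simp only [thinBeam, directions, Pi.sub_apply, Pi.add_apply, Pi.smul_apply, h1]
    module

/-! ### Completeness of the invariant. -/

/-- Beams with the same nomenclature and the same characteristic are joined by a path. -/
lemma joined_of_carF_eq {N : ℕ} {F F' : Faisc N} (hn : nomenclatureF F = nomenclatureF F')
    (hc : carF F = carF F') : Joined F F' := by
  have hF := directions_mem F
  have hF' := directions_mem F'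
  rw [← hc] at hF'
  have he : ∀ j : Fin N, -(((carF F j : ℤ) : ℝ) * (-1) ^ ((j : ℕ) + 1)) ≠ 0 := by
    intro j
    rcases Int.units_eq_one_or (carF F j) with h | h <;> simp [h]
  have hJ := joinedIn_Directed he hF hF' (joinedIn_LO hn)
  -- All three paths exist for every small `s > 0`; a common `s` makes their ends match.
  have h := ((eventually_joinedIn_thinBeam hJ).and
    ((eventually_joinedIn_thinBeam_directions F.2).and
      (eventually_joinedIn_thinBeam_directions F'.2))).filter_mono
    (nhdsWithin_le_nhds (s := Set.Ioi (0 : ℝ)))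
  obtain ⟨s, ⟨h1, h2, h3⟩, hs⟩ := (h.and self_mem_nhdsWithin).exists
  exact (joinedIn_iff_joined F.2 F'.2).1 (((h2 hs).trans (h1 hs)).trans (h3 hs).symm)

/-- The signature determines the characteristic up to sign. -/
lemma carF_eq_or_neg {N : ℕ} {F F' : Faisc N} (h : signF F = signF F') :
    carF F = carF F' ∨ carF F = -carF F' := by
  -- Equal signatures mean that both characteristics change sign at the same places, so their
  -- product does not depend on the mirror.
  have hstep : ∀ (k : ℕ) (hk : k + 1 < N), carF F ⟨k, by omega⟩ * carF F' ⟨k, by omega⟩ =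
      carF F ⟨k + 1, hk⟩ * carF F' ⟨k + 1, hk⟩ := by
    intro k hk
    have hs := congrFun h ⟨k, by omega⟩
    simp only [signF] at hs
    generalize carF F ⟨k, _⟩ = x at *
    generalize carF F' ⟨k, _⟩ = y at *
    generalize carF F ⟨k + 1, hk⟩ = z at *
    generalize carF F' ⟨k + 1, hk⟩ = w at *
    revert x y z w
    decide
  rcases Nat.eq_zero_or_pos N with rfl | hN
  · left
    funext j
    exact j.elim0
  have hall : ∀ (k : ℕ) (hk : k < N), carF F ⟨k, hk⟩ * carF F' ⟨k, hk⟩ =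
      carF F ⟨0, hN⟩ * carF F' ⟨0, hN⟩ := by
    intro k
    induction k with
    | zero => intro _; rfl
    | succ k ih => intro hk; rw [← hstep k hk, ih]
  have hfin : ∀ x y : ℤˣ, (x * y = 1 → x = y) ∧ (x * y = -1 → x = -y) := by decide
  rcases Int.units_eq_one_or (carF F ⟨0, hN⟩ * carF F' ⟨0, hN⟩) with e | e
  · left
    funext j
    exact (hfin _ _).1 ((hall j j.2).trans e)
  · right
    funext j
    exact (hfin _ _).2 ((hall j j.2).trans e)

/-- When the characteristics are opposite, the second beam is replaced by its inverse, which
represents the same symmetrical beam and has the opposite characteristic. -/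
lemma joined_of_invariantS_eq {N : ℕ} {F F' : FaiscSym N} (h : invariantS F = invariantS F') :
    Joined F F' := by
  induction F using Quotient.inductionOn with | _ F
  induction F' using Quotient.inductionOn with | _ F'
  obtain ⟨hn, hs⟩ := Prod.ext_iff.1 h
  change nomenclatureF F = nomenclatureF F' at hn
  change signF F = signF F' at hs
  have hmap : ∀ {G G' : Faisc N}, Joined G G' →
      Joined (Quotient.mk (AddAction.orbitRel (ZMod 2) (Faisc N)) G) (Quotient.mk _ G') :=
    fun hj => hj.map continuous_quotient_mk'
  rcases carF_eq_or_neg hs with hc | hc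
  · exact hmap (joined_of_carF_eq hn hc)
  · have e : Quotient.mk (AddAction.orbitRel (ZMod 2) (Faisc N)) (invBeam F') =
        Quotient.mk _ F' :=
      Quotient.sound ⟨1, if_neg (by decide)⟩
    rw [← e]
    refine hmap (joined_of_carF_eq (hn.trans (nomenclatureF_inv F').symm) ?_)
    rw [hc]
    funext j
    exact (carF_inv F' j).symm

end OpticalBeam

end

/-- The relations close up in a cycle: equal invariants give a path, a path gives a common
component, and a common component gives equal invariants. -/
theorem mainTheorem5 (N : ℕ) (hN : 1 ≤ N) :
    OpticalBeam.IsExactInvariant (OpticalBeam.invariantS (N := N)) ∧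
      ∀ F F' : OpticalBeam.FaiscSym N,
        OpticalBeam.invariantS F = OpticalBeam.invariantS F' ↔
          connectedComponent F = connectedComponent F' := by
  have key : ∀ F F' : OpticalBeam.FaiscSym N, Joined F F' →
      connectedComponent F = connectedComponent F' := fun F F' h =>
    connectedComponent_eq (pathComponent_subset_component F h)
  refine ⟨⟨fun F F' h => OpticalBeam.invariantS_eq_of_connectedComponent_eq (key F F' h),
    fun F F' h => OpticalBeam.joined_of_invariantS_eq h⟩, fun F F' => ⟨fun h =>
    key F F' (OpticalBeam.joined_of_invariantS_eq h),
    OpticalBeam.invariantS_eq_of_connectedComponent_eq⟩⟩
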